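/- Let $\mathbb S_n=\{x\in\mathbb R^n:\ x_i\ge 0,\ \sum_i x_i=1\}$, $n\ge 1$. Let $(f_j)_{j\in J}$ be a (possibly infinite) family of functions on $\mathbb R^n$ that are convex on $\mathbb S_n$ and differentiable at every point of $\mathbb S_n$, with $\|\nabla f_j(x)\|_2\le G$ for all $j\in J$, $x\in\mathbb S_n$, and let $\varepsilon>0$. Consider the program: find $x\in\mathbb S_n$ with $f_j(x)\le 0$ for all $j\in J$. No strict convexity is assumed. The computational model is a real RAM (exact real arithmetic, unit-cost elementary operations) with three oracles: a separation oracle, which on $x\in\mathbb S_n$ returns some $j\in J$ with $f_j(x)>\varepsilon$ if there is one and FAIL otherwise; a gradient oracle, which returns $\nabla f_j(x)$ for the constraint $j$ named last by the separation oracle; and a generalized projection oracle, which for $y\in\mathbb R^n$ and a positive semidefinite $A$ returns a minimizer of $(x-y)^\top A(x-y)$ over $x\in\mathbb S_n$. **Theorem.** There are a single program for this machine and constants $C,k$ such that for all $n$, $G\ge0$, $\varepsilon>0$, all families $(f_j)_{j\in J}$ as above and all oracles as above, the program, on input $(n,G,\varepsilon)$, halts and returns an $\varepsilon$-approximate solution,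 that is, either * a point $x\in\mathbb S_n$ with $f_j(x)\le\varepsilon$ for all $j\in J$, or * a proof that the program is infeasible: a finite list $j_1,\dots,j_T\in J$ such that the uniform distribution on it is a dual solution of the transformed program $\log(e-f_j(x)/\omega)\ge 1$ $(j\in J)$, where $\omega=2G+\varepsilon$; that is, $\frac1T\sum_{t=1}^T\log\bigl(e-f_{j_t}(x)/\omega\bigr)<1$ for every $x\in\mathbb S_n$ (with $\log y=-\infty$ for $y\le 0$). It makes at most $$C\Bigl(1+\frac{nG}{\varepsilon}\Bigr)\log^k\Bigl(2+\frac{nG}{\varepsilon}\Bigr)=\tilde O\Bigl(1+\frac{nG}{\varepsilon}\Bigr)$$ calls to the separation oracle. Between two successive such calls (and likewise before the first and after the last one) it makes at most one generalized projection, at most one gradient computation, and at most $C\,n^2(1+\log n)^k=\tilde O(n^2)$ additional elementary steps. -/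

import Mathlib

noncomputable section

namespace RealRAM

/-! ### The mathematical program -/

/-- `n`-dimensional Euclidean space. -/
abbrev Vec (n : ℕ) : Type := EuclideanSpace ℝ (Fin n)

/-- The unit simplex `{x ∈ ℝⁿ : ∑ xᵢ = 1, xᵢ ≥ 0}`. -/
def simplex (n : ℕ) : Set (Vec n) := {x | (x : Fin n → ℝ) ∈ stdSimplex ℝ (Fin n)}

/-- `x` is an `ε`-approximate solution of the program `f_j(x) ≤ 0 (j ∈ ι), x ∈ simplex`. -/
def IsApproxSolution {n : ℕ} {ι : Type*} (f : ι → Vec n → ℝ) (ε : ℝ) (x : Vec n) : Prop :=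
  x ∈ simplex n ∧ ∀ j, f j x ≤ ε

/-- The uniform distribution on the list `L = [j₁, …, j_T]` of constraints is a dual solution
of the transformed program `log (e - f_j(x) / ω) ≥ 1 (j ∈ ι), x ∈ simplex`: for each `x` in the
simplex the average of `log (e - f_{j_t}(x) / ω)` over `t` is smaller than `1`, where `log y = -∞`
for `y ≤ 0`. The inequality is written in exponential form. -/
def IsDualProof {n : ℕ} {ι : Type*} (f : ι → Vec n → ℝ) (ω : ℝ) (L : List ι) : Prop :=
  0 < ω ∧ ∀ x ∈ simplex n,
    (L.map fun j => max 0 (Real.exp 1 - f j x / ω)).prod < Real.exp 1 ^ L.length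

/-- A dual proof shows that already the listed constraints have no common solution. -/
theorem IsDualProof.infeasible {n : ℕ} {ι : Type*} {f : ι → Vec n → ℝ} {ω : ℝ} {L : List ι}
    (h : IsDualProof f ω L) : ¬ ∃ x ∈ simplex n, ∀ j ∈ L, f j x ≤ 0 := by
  rintro ⟨x, hx, hL⟩
  have key : ∀ M : List ι, (∀ j ∈ M, f j x ≤ 0) →
      Real.exp 1 ^ M.length ≤ (M.map fun j => max 0 (Real.exp 1 - f j x / ω)).prod := by
    intro M
    induction M with
    | nil => simp
    | cons a M ih =>
      intro hM
      have h1 := ih fun j hj => hM j (List.mem_cons_of_mem a hj)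
      have h2 : f a x / ω ≤ 0 := div_nonpos_of_nonpos_of_nonneg (hM a (by simp)) h.1.le
      have h3 : Real.exp 1 ≤ max 0 (Real.exp 1 - f a x / ω) := le_max_of_le_right (by linarith)
      simp only [List.map_cons, List.prod_cons, List.length_cons, pow_succ']
      exact mul_le_mul h3 h1 (by positivity) (le_max_left _ _)
  exact absurd (h.2 x hx) (not_lt.mpr (key L hL))

/-- A separation oracle with tolerance `ε`: on `x` in the simplex it names a constraint with
`f_j(x) > ε` if there is one, and answers FAIL (`none`) otherwise. -/
def IsSeparationOracle {n : ℕ} {ι : Type*} (f : ι → Vec n → ℝ) (ε : ℝ)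
    (O : Vec n → Option ι) : Prop :=
  ∀ x ∈ simplex n, (∀ j, O x = some j → ε < f j x) ∧ (O x = none → ∀ j, f j x ≤ ε)

/-- A generalized projection onto the simplex: `P y A` minimizes `(x - y)ᵀ A (x - y)` over `x`
in the simplex, for every `y` and every positive semidefinite `A`. -/
def IsGeneralizedProjection {n : ℕ}
    (P : Vec n → Matrix (Fin n) (Fin n) ℝ → Vec n) : Prop :=
  ∀ (y : Vec n) (A : Matrix (Fin n) (Fin n) ℝ), A.PosSemidef →
    P y A ∈ simplex n ∧
      IsMinOn (fun x : Vec n => (x - y).ofLp ⬝ᵥ A.mulVec (x - y).ofLp) (simplex n) (P y A)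

/-! ### The machine model: while programs on a real RAM with oracles

A program is a finite piece of code that does not depend on the instance. The memory consists of
natural number registers (used for counting and addressing), real registers, real vectors and
real matrices. Arithmetic on reals is exact, and every elementary operation costs one step. -/

/-- Index expressions. -/
inductive NExpr : Type
  | const (c : ℕ)
  | var (i : ℕ)
  | add (a b : NExpr)

/-- Real expressions; `vecGet v i` is the entry `i` of vector `v`, and `matGet m i j` is the
entry `(i, j)` of matrix `m`. -/
inductive RExpr : Type
  | const (q : ℚ)
  | var (i : ℕ)
  | ofNat (a : NExpr)
  | vecGet (v : ℕ) (i : NExpr)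
  | matGet (m : ℕ) (i j : NExpr)
  | add (a b : RExpr)
  | sub (a b : RExpr)
  | mul (a b : RExpr)
  | div (a b : RExpr)

/-- Tests. -/
inductive BExpr : Type
  | natLt (a b : NExpr)
  | realLt (a b : RExpr)
  | not (a : BExpr)
  | and (a b : BExpr)

/-- Programs. -/
inductive Prog : Type
  | skip
  | setNat (i : ℕ) (e : NExpr)
  | setReal (i : ℕ) (e : RExpr)
  | setVec (v : ℕ) (i : NExpr) (e : RExpr)
  | setMat (m : ℕ) (i j : NExpr) (e : RExpr)
  /-- Call the separation oracle at vector `v`. If it names a constraint, this becomes the current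
  constraint and natural register `r` is set to `1`; on FAIL, register `r` is set to `0`. -/
  | separate (v r : ℕ)
  /-- Store the gradient of the current constraint at vector `v` in vector `w`. -/
  | gradient (v w : ℕ)
  /-- Store the generalized projection of vector `v` with respect to matrix `m` in vector `w`. -/
  | project (v m w : ℕ)
  /-- Append the current constraint to the output list. -/
  | emit
  | seq (p q : Prog)
  | branch (b : BExpr) (p q : Prog)
  | loop (b : BExpr) (p : Prog)

/-- The memory. Constraint names are abstract tokens for the machine: it keeps the current constraint and
a list of constraints that it outputs. -/
structure State (ι : Type*) where
  nat : ℕ → ℕ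
  real : ℕ → ℝ
  vec : ℕ → ℕ → ℝ
  mat : ℕ → ℕ → ℕ → ℝ
  cur : Option ι
  out : List ι

/-- The three oracles for an instance of dimension `n`. -/
structure Oracles (n : ℕ) (ι : Type*) where
  separate : Vec n → Option ι
  gradient : ι → Vec n → Vec n
  project : Vec n → Matrix (Fin n) (Fin n) ℝ → Vec n

/-- What a run leaves in its trace: elementary steps and the three kinds of oracle calls. -/
inductive Event : Type
  | step
  | separate
  | gradient
  | project
  deriving DecidableEq

/-- Number of operations in an index expression. -/
def NExpr.cost : NExpr → ℕ
  | .const _ => 1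
  | .var _ => 1
  | .add a b => a.cost + b.cost + 1

/-- Number of operations in a real expression. -/
def RExpr.cost : RExpr → ℕ
  | .const _ => 1
  | .var _ => 1
  | .ofNat a => a.cost + 1
  | .vecGet _ i => i.cost + 1
  | .matGet _ i j => i.cost + j.cost + 1
  | .add a b => a.cost + b.cost + 1
  | .sub a b => a.cost + b.cost + 1
  | .mul a b => a.cost + b.cost + 1
  | .div a b => a.cost + b.cost + 1

/-- Number of operations in a test. -/
def BExpr.cost : BExpr → ℕ
  | .natLt a b => a.cost + b.cost + 1
  | .realLt a b => a.cost + b.cost + 1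
  | .not a => a.cost + 1
  | .and a b => a.cost + b.cost + 1

variable {ι : Type*}

/-- Value of an index expression. -/
def NExpr.eval (s : State ι) : NExpr → ℕ
  | .const c => c
  | .var i => s.nat i
  | .add a b => a.eval s + b.eval s

/-- Value of a real expression. -/
def RExpr.eval (s : State ι) : RExpr → ℝ
  | .const q => (q : ℝ)
  | .var i => s.real i
  | .ofNat a => (a.eval s : ℝ)
  | .vecGet v i => s.vec v (i.eval s)
  | .matGet m i j => s.mat m (i.eval s) (j.eval s)
  | .add a b => a.eval s + b.eval s
  | .sub a b => a.eval s - b.eval s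
  | .mul a b => a.eval s * b.eval s
  | .div a b => a.eval s / b.eval s

/-- Truth of a test. -/
def BExpr.holds (s : State ι) : BExpr → Prop
  | .natLt a b => a.eval s < b.eval s
  | .realLt a b => a.eval s < b.eval s
  | .not a => ¬ a.holds s
  | .and a b => a.holds s ∧ b.holds s

/-- The point of `ℝⁿ` held in the first `n` entries of vector `v`. -/
def State.getVec (s : State ι) (n v : ℕ) : Vec n := WithLp.toLp 2 fun i : Fin n => s.vec v i

/-- The `n × n` matrix held in the leading entries of matrix `m`. -/
def State.getMat (s : State ι) (n m : ℕ) : Matrix (Fin n) (Fin n) ℝ :=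
  Matrix.of fun i j => s.mat m i j

/-- Write `x` to the first `n` entries of vector `w`. -/
def State.putVec {n : ℕ} (s : State ι) (w : ℕ) (x : Vec n) : State ι :=
  { s with
    vec := Function.update s.vec w (fun i => if h : i < n then x ⟨i, h⟩ else s.vec w i) }

/-- The effect of the answer of the separation oracle. -/
def State.answer (s : State ι) (r : ℕ) : Option ι → State ι
  | some j => { s with cur := some j, nat := Function.update s.nat r 1 }
  | none => { s with nat := Function.update s.nat r 0 }

/-- The effect of a gradient computation (none if there is no current constraint). -/
def State.gradientStep {n : ℕ} (s : State ι) (O : Oracles n ι) (v w : ℕ) : State ι :=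
  match s.cur with
  | some j => s.putVec w (O.gradient j (s.getVec n v))
  | none => s

/-- `k` elementary steps. -/
def steps (k : ℕ) : List Event := List.replicate k Event.step

/-- `Exec O p s t s'`: started in state `s`, the program `p` terminates in state `s'`, and `t` is
the chronological list of its elementary steps and oracle calls. -/
inductive Exec {n : ℕ} (O : Oracles n ι) : Prog → State ι → List Event → State ι → Prop
  | skip (s) : Exec O .skip s [] s
  | setNat (i e s) : Exec O (.setNat i e) s (steps (e.cost + 1))
      { s with nat := Function.update s.nat i (e.eval s) }
  | setReal (i e s) : Exec O (.setReal i e) s (steps (e.cost + 1))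
      { s with real := Function.update s.real i (e.eval s) }
  | setVec (v i e s) : Exec O (.setVec v i e) s (steps (i.cost + e.cost + 1))
      { s with
        vec := Function.update s.vec v (Function.update (s.vec v) (i.eval s) (e.eval s)) }
  | setMat (m i j e s) : Exec O (.setMat m i j e) s (steps (i.cost + j.cost + e.cost + 1))
      { s with
        mat := Function.update s.mat m (Function.update (s.mat m) (i.eval s)
          (Function.update (s.mat m (i.eval s)) (j.eval s) (e.eval s))) }
  | separate (v r s) : Exec O (.separate v r) s [Event.separate]
      (s.answer r (O.separate (s.getVec n v)))
  | gradient (v w s) : Exec O (.gradient v w) s [Event.gradient] (s.gradientStep O v w)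
  | project (v m w s) : Exec O (.project v m w) s [Event.project]
      (s.putVec w (O.project (s.getVec n v) (s.getMat n m)))
  | emit (s) : Exec O .emit s (steps 1) { s with out := s.out ++ s.cur.toList }
  | seq {p q s₁ s₂ s₃ t t'} : Exec O p s₁ t s₂ → Exec O q s₂ t' s₃ →
      Exec O (.seq p q) s₁ (t ++ t') s₃
  | branchTrue {b p q s s' t} : b.holds s → Exec O p s t s' →
      Exec O (.branch b p q) s (steps b.cost ++ t) s'
  | branchFalse {b p q s s' t} : ¬ b.holds s → Exec O q s t s' →
      Exec O (.branch b p q) s (steps b.cost ++ t) s'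
  | loopDone {b p s} : ¬ b.holds s → Exec O (.loop b p) s (steps b.cost) s
  | loopStep {b p s₁ s₂ s₃ t t'} : b.holds s₁ → Exec O p s₁ t s₂ →
      Exec O (.loop b p) s₂ t' s₃ → Exec O (.loop b p) s₁ (steps b.cost ++ t ++ t') s₃

/-- The input: natural register `0` holds `n`, real registers `0` and `1` hold `G` and `ε`;
everything else is zero or empty. -/
def State.input (ι : Type*) (n : ℕ) (G ε : ℝ) : State ι where
  nat := Function.update (fun _ => 0) 0 n
  real := Function.update (Function.update (fun _ => 0) 0 G) 1 ε
  vec := fun _ _ => 0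
  mat := fun _ _ _ => 0
  cur := none
  out := []

/-- The output is correct. If natural register `1` holds `1`, the machine returns the point in
vector `0`, which has to be an `ε`-approximate solution; otherwise it returns the output list,
which has to be a dual proof of infeasibility, for the scale `ω`. -/
def State.Correct {n : ℕ} (s : State ι) (f : ι → Vec n → ℝ) (ε ω : ℝ) : Prop :=
  (s.nat 1 = 1 ∧ IsApproxSolution f ε (s.getVec n 0)) ∨
    (s.nat 1 ≠ 1 ∧ IsDualProof f ω s.out)

end RealRAM

end

/-! ### Cost calculus for oracle-free code. -/

namespace RealRAM

variable {ι : Type*} {n : ℕ} {O : Oracles n ι}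

/-! The algorithm is follow-the-leader with quadratic losses. Put ω = 2G + ε and ρ = e - ε/ω. When
the oracle names f_j at x, with gradient h there, convexity gives e - f_j(y)/ω ≤ ρ + u for all y in
the simplex, where u = a·y and a = `cutVec h x ω`; moreover a·x = 0 and |u| ≤ 3/4. Since 17/10 ≤ ρ ≤
3, log(1 + u/ρ) ≤ (u - u²/12)/ρ, and u - u²/12 = 3 - (6 - u)²/12. Coordinates sum to 1, so 6 - u =
w·y with w = 6·1 - a: the loss is a homogeneous rank-one form. The matrix A = n·1 + Σ w wᵀ therefore
carries the whole history, and the next iterate, the minimizer of yᵀAy on the simplex, is a single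
generalized projection of 0.

Every iterate has loss (w·x)² = 36. Strong minimality of the leader together with a log-determinant
potential for B = n·1 + Σ a aᵀ gives yᵀAy ≥ 36(T - n log(1 + T)) on the simplex (`neg_log_det_le`,
`RegretBound.succ`, `RegretBound.le`). Hence Σ log(e - f_{j_t}(y)/ω) ≤ T log ρ + O(n log(1 + T))
(`DualBound.append`). As log ρ ≤ 1 - ε/(3ω), the right side is below T once 9ωn(1 + m) < Tε, where
2^m ≥ T + 1 (`isDualProof_of_bounds`).

If ε ≤ 2G, then ω ≤ 4G and this test succeeds within Õ(nG/ε) rounds (`count_le_of_le_log`). If 2G <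
ε, one violated constraint is already positive on the whole simplex (`isDualProof_singleton`). A
round costs one inner product and one rank-one update, hence O(n²) steps. -/

theorem steps_add (a b : ℕ) : steps a ++ steps b = steps (a + b) := by
  simp [steps]

/-- Started in `s`, the program `p` makes at most `c` elementary steps and no oracle calls, and
ends in a state with property `Q`. -/
def Computes (O : Oracles n ι) (p : Prog) (s : State ι) (c : ℕ) (Q : State ι → Prop) : Prop :=
  ∃ k ≤ c, ∃ s', Exec O p s (steps k) s' ∧ Q s'

theorem Computes.mono {p : Prog} {s : State ι} {c c' : ℕ} {Q Q' : State ι → Prop}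
    (h : Computes O p s c Q) (hc : c ≤ c') (hQ : ∀ s', Q s' → Q' s') : Computes O p s c' Q' := by
  obtain ⟨k, hk, s', he, hs⟩ := h
  exact ⟨k, hk.trans hc, s', he, hQ s' hs⟩

theorem Computes.seq {p q : Prog} {s : State ι} {c d : ℕ} {Q R : State ι → Prop}
    (hp : Computes O p s c Q) (hq : ∀ s', Q s' → Computes O q s' d R) :
    Computes O (.seq p q) s (c + d) R := by
  obtain ⟨k, hk, s', he, hs⟩ := hp
  obtain ⟨l, hl, s'', he', hs'⟩ := hq s' hs
  exact ⟨k + l, by omega, s'', steps_add k l ▸ he.seq he', hs'⟩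

theorem Computes.of_exec {p : Prog} {s s' : State ι} {c : ℕ} {Q : State ι → Prop}
    (h : Exec O p s (steps c) s') (hQ : Q s') : Computes O p s c Q :=
  ⟨c, le_rfl, s', h, hQ⟩

theorem Computes.skip {s : State ι} {Q : State ι → Prop} (hQ : Q s) :
    Computes O .skip s 0 Q :=
  .of_exec (.skip s) hQ

theorem Computes.branch {b : BExpr} {p q : Prog} {s : State ι} {c d : ℕ} {Q : State ι → Prop}
    (hp : b.holds s → Computes O p s c Q) (hq : ¬ b.holds s → Computes O q s d Q) :
    Computes O (.branch b p q) s (b.cost + (c + d)) Q := by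
  by_cases hb : b.holds s
  · obtain ⟨k, hk, s', he, hs⟩ := hp hb
    exact ⟨b.cost + k, by omega, s', steps_add _ _ ▸ .branchTrue hb he, hs⟩
  · obtain ⟨k, hk, s', he, hs⟩ := hq hb
    exact ⟨b.cost + k, by omega, s', steps_add _ _ ▸ .branchFalse hb he, hs⟩

/-- `for i < n do body`, started with register `i` at its present value. -/
def forLoop (i : ℕ) (body : Prog) : Prog :=
  .loop (.natLt (.var i) (.var 0)) (.seq body (.setNat i (.add (.var i) (.const 1))))

/-- A round costs 3 for the test and 4 for the increment besides the body; the last 3 is the failing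
test. -/
theorem Computes.forLoop_from {i c m : ℕ} {body : Prog} (I : ℕ → State ι → Prop)
    (hI : ∀ k s, I k s → s.nat i = k ∧ s.nat 0 = m)
    (hbody : ∀ k s, k < m → I k s → Computes O body s c fun s' =>
      s'.nat i = k ∧ I (k + 1) { s' with nat := Function.update s'.nat i (k + 1) })
    (l : ℕ) : ∀ k s, k + l = m → I k s →
      Computes O (forLoop i body) s (l * (c + 7) + 3) (I m) := by
  induction l with
  | zero =>
    intro k s hk hs
    obtain ⟨h1, h2⟩ := hI k s hs
    obtain rfl : k = m := by omega
    refine ⟨3, by omega, s, ?_, hs⟩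
    exact Exec.loopDone (by simp [BExpr.holds, NExpr.eval, h1, h2])
  | succ l ih =>
    intro k s hk hs
    obtain ⟨h1, h2⟩ := hI k s hs
    obtain ⟨k₁, hk₁, s₁, he₁, hs₁, hI₁⟩ := hbody k s (by omega) hs
    obtain ⟨k₂, hk₂, s₂, he₂, hs₂⟩ := ih (k + 1) _ (by omega) hI₁
    refine ⟨3 + (k₁ + 4) + k₂, by nlinarith, s₂, ?_, hs₂⟩
    have hinc := Exec.setNat (O := O) i (.add (.var i) (.const 1)) s₁
    simp only [NExpr.eval, hs₁] at hinc
    have := Exec.loopStep (b := .natLt (.var i) (.var 0))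
      (by simp only [BExpr.holds, NExpr.eval, h1, h2]; omega) (he₁.seq hinc) he₂
    simpa [forLoop, steps_add, BExpr.cost, NExpr.cost] using this

theorem Computes.forLoop {i c m : ℕ} {body : Prog} (I : ℕ → State ι → Prop)
    (hI : ∀ k s, I k s → s.nat i = k ∧ s.nat 0 = m)
    (hbody : ∀ k s, k < m → I k s → Computes O body s c fun s' =>
      s'.nat i = k ∧ I (k + 1) { s' with nat := Function.update s'.nat i (k + 1) })
    {s : State ι} (hs : I 0 s) :
    Computes O (forLoop i body) s (m * (c + 7) + 3) (I m) :=
  Computes.forLoop_from I hI hbody m 0 s (by omega) hs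

/-! ### Subroutines: inner product, rank-one update, stopping test, initialization. -/

/-- Two states that agree except on the real register `2`, the natural registers `7`, `8` and the
matrices. -/
structure State.SameBase (s s' : State ι) : Prop where
  nat : ∀ r, r ≠ 7 → r ≠ 8 → s'.nat r = s.nat r
  real : ∀ r, r ≠ 2 → s'.real r = s.real r
  vec : s'.vec = s.vec
  cur : s'.cur = s.cur
  out : s'.out = s.out

theorem State.SameBase.trans {s s' s'' : State ι} (h : s.SameBase s') (h' : s'.SameBase s'') :
    s.SameBase s'' where
  nat r h7 h8 := (h'.nat r h7 h8).trans (h.nat r h7 h8)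
  real r hr := (h'.real r hr).trans (h.real r hr)
  vec := h'.vec.trans h.vec
  cur := h'.cur.trans h.cur
  out := h'.out.trans h.out

theorem State.SameBase.setNat {s s' : State ι} (h : s.SameBase s') {r : ℕ} (hr : r = 7 ∨ r = 8)
    (v : ℕ) : s.SameBase { s' with nat := Function.update s'.nat r v } where
  nat q h7 h8 := by
    have : q ≠ r := by omega
    simpa [this] using h.nat q h7 h8
  real := h.real
  vec := h.vec
  cur := h.cur
  out := h.out

theorem State.SameBase.refl (s : State ι) : s.SameBase s where
  nat _ _ _ := rfl
  real _ _ := rfl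
  vec := rfl
  cur := rfl
  out := rfl

/-- Real register `2` becomes the inner product of vectors `2` and `0`. -/
def dotProg : Prog :=
  .seq (.setReal 2 (.const 0)) <| .seq (.setNat 7 (.const 0)) <|
    forLoop 7 (.setReal 2 (.add (.var 2) (.mul (.vecGet 2 (.var 7)) (.vecGet 0 (.var 7)))))

theorem computes_dotProg {s : State ι} {m : ℕ} (hm : s.nat 0 = m) :
    Computes O dotProg s (m * 15 + 7) fun s' => s.SameBase s' ∧ s'.mat = s.mat ∧
      s'.real 2 = ∑ i ∈ Finset.range m, s.vec 2 i * s.vec 0 i := by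
  refine Computes.mono (Computes.seq (.of_exec (.setReal ..) rfl) fun s₁ h₁ =>
    Computes.seq (.of_exec (.setNat ..) rfl) fun s₂ h₂ =>
    (Computes.forLoop (c := 8) (m := m) (fun k s' => s'.nat 7 = k ∧ s.SameBase s' ∧ s'.mat = s.mat ∧
      s'.real 2 = ∑ i ∈ Finset.range k, s.vec 2 i * s.vec 0 i) ?_ ?_ ?_)) ?_ ?_
  · rintro k s' ⟨h7, hb, -⟩
    exact ⟨h7, by rw [hb.nat 0 (by norm_num) (by norm_num), hm]⟩
  · rintro k s' hk ⟨h7, hb, hmat, h2⟩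
    refine Computes.of_exec (.setReal ..) ⟨h7, by simp, ?_, by simpa using hmat, ?_⟩
    · refine ⟨fun r h7' h8' => ?_, fun r hr => ?_, hb.vec, hb.cur, hb.out⟩
      · simpa [h7'] using hb.nat r h7' h8'
      · simpa [hr] using hb.real r hr
    · simp [RExpr.eval, NExpr.eval, h7, hb.vec, h2, Finset.sum_range_succ]
  · subst h₁ h₂
    refine ⟨by simp [NExpr.eval], ?_, rfl, by simp [RExpr.eval]⟩
    exact ⟨fun r hr _ => by simp [hr], fun r hr => by simp [hr], rfl, rfl, rfl⟩
  · simp only [NExpr.cost, RExpr.cost]; omega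
  · rintro s' ⟨-, h⟩
    exact h

/-- The entry of the update vector with index in natural register `i`. -/
def updExpr (i : ℕ) : RExpr :=
  .add (.const 6) (.div (.sub (.vecGet 2 (.var i)) (.var 2)) (.var 4))

/-- The vector `6 + (h - r) / ω`. -/
noncomputable def State.upd (s : State ι) (a : ℕ) : ℝ := 6 + (s.vec 2 a - s.real 2) / s.real 4

/-- Adds the outer square of the update vector to matrix `0`. -/
def outerProg : Prog :=
  .seq (.setNat 7 (.const 0)) <| forLoop 7 <| .seq (.setNat 8 (.const 0)) <|
    forLoop 8 (.setMat 0 (.var 7) (.var 8)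
      (.add (.matGet 0 (.var 7) (.var 8)) (.mul (updExpr 7) (updExpr 8))))

theorem computes_outerProg {s : State ι} {m : ℕ} (hm : s.nat 0 = m) :
    Computes O outerProg s (m * (m * 31 + 12) + 5) fun s' => s.SameBase s' ∧
      s'.real 2 = s.real 2 ∧
      ∀ a < m, ∀ b < m, s'.mat 0 a b = s.mat 0 a b + s.upd a * s.upd b := by
  refine Computes.mono (Computes.seq (.of_exec (.setNat ..) rfl) fun s₁ h₁ =>
    (Computes.forLoop (c := m * 31 + 5) (m := m) (fun k s' => s'.nat 7 = k ∧ s.SameBase s' ∧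
      s'.real 2 = s.real 2 ∧ ∀ a < m, ∀ b < m,
        s'.mat 0 a b = s.mat 0 a b + if a < k then s.upd a * s.upd b else 0)
      ?_ ?_ ?_)) ?_ ?_
  · rintro k s' ⟨h7, hb, -⟩
    exact ⟨h7, by rw [hb.nat 0 (by norm_num) (by norm_num), hm]⟩
  · rintro k s₂ hk ⟨h7, hb, h2, hA⟩
    refine Computes.mono (Computes.seq (.of_exec (.setNat ..) rfl) fun s₃ h₃ =>
      (Computes.forLoop (c := 24) (m := m) (fun l s' => s'.nat 8 = l ∧ s'.nat 7 = k ∧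
        s.SameBase s' ∧ s'.real 2 = s.real 2 ∧ ∀ a < m, ∀ b < m,
          s'.mat 0 a b = s.mat 0 a b + if a < k ∨ a = k ∧ b < l then s.upd a * s.upd b else 0)
        ?_ ?_ ?_)) ?_ ?_
    · rintro l s' ⟨h8, -, hb, -⟩
      exact ⟨h8, by rw [hb.nat 0 (by norm_num) (by norm_num), hm]⟩
    · rintro l s' hl ⟨h8, h7, hb, h2, hA⟩
      refine Computes.of_exec (Exec.setMat 0 (.var 7) (.var 8) (.add (.matGet 0 (.var 7) (.var 8))
        (.mul (updExpr 7) (updExpr 8))) s') ⟨h8, by simp, by simpa using h7, ?_, h2, ?_⟩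
      · exact ⟨fun r h7' h8' => by simpa [h8'] using hb.nat r h7' h8', hb.real, hb.vec, hb.cur,
          hb.out⟩
      · intro a ha b hb'
        have hu : ∀ i, (updExpr i).eval s' = s.upd (s'.nat i) := by
          intro i
          simp [updExpr, RExpr.eval, NExpr.eval, State.upd, hb.vec, h2, hb.real 4]
        simp only [RExpr.eval, NExpr.eval, hu, h7, h8, Function.update_self]
        by_cases hak : a = k
        · subst hak
          by_cases hbl : b = l
          · subst hbl
            simp [hA _ ha _ hb']
          · simp only [Function.update_self, Function.update_of_ne hbl, hA _ ha _ hb']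
            have : b < l + 1 ↔ b < l := by omega
            simp [this]
        · simp only [Function.update_of_ne hak, hA _ ha _ hb']
          simp [hak]
    · subst h₃
      refine ⟨by simp [NExpr.eval], by simpa using h7, hb.setNat (.inr rfl) _, h2, ?_⟩
      simpa using hA
    · simp only [NExpr.cost]; omega
    · rintro s' ⟨-, h7, hb, h2, hA⟩
      refine ⟨h7, by simp, hb.setNat (.inl rfl) _, h2, fun a ha b hb' => ?_⟩
      rw [hA a ha b hb']
      have : a < k ∨ a = k ∧ b < m ↔ a < k + 1 := by omega
      simp [this]
  · subst h₁
    exact ⟨by simp [NExpr.eval], (State.SameBase.refl s).setNat (.inl rfl) _, rfl, by simp⟩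
  · simp only [NExpr.cost]; ring_nf; omega
  · rintro s' ⟨-, hb, h2, hA⟩
    refine ⟨hb, h2, fun a ha b hb' => ?_⟩
    simp [hA a ha b hb', ha]

/-- Counts the iteration, records the constraint and tests whether the recorded constraints form
a dual proof. -/
def finishProg : Prog :=
  .seq (.setNat 4 (.add (.var 4) (.const 1))) <|
  -- Register 5 is the power of two with exponent in register 6, doubled when it falls below T + 1.
  -- The exponent replaces log(1 + T), which the machine cannot compute.
  .seq (.branch (.natLt (.var 5) (.add (.var 4) (.const 1)))
    (.seq (.setNat 5 (.add (.var 5) (.var 5))) (.setNat 6 (.add (.var 6) (.const 1)))) .skip) <|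
  .seq .emit <|
  .branch (.realLt (.mul (.var 3) (.add (.const 1) (.ofNat (.var 6))))
    (.mul (.ofNat (.var 4)) (.var 1))) (.setNat 2 (.const 1)) .skip

/-- What `finishProg` leaves unchanged, and what it appends to the output. -/
structure State.Finished (s s' : State ι) : Prop where
  nat : ∀ r < 2, s'.nat r = s.nat r
  nat4 : s'.nat 4 = s.nat 4 + 1
  nat56 : s'.nat 5 = s.nat 5 ∧ s'.nat 6 = s.nat 6 ∧ s.nat 4 + 2 ≤ s.nat 5 ∨
    s'.nat 5 = s.nat 5 + s.nat 5 ∧ s'.nat 6 = s.nat 6 + 1 ∧ s.nat 5 < s.nat 4 + 2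
  nat2 : s'.nat 2 = 1 ∧ s.real 3 * (1 + s'.nat 6) < s'.nat 4 * s.real 1 ∨
    s'.nat 2 = s.nat 2 ∧ s'.nat 4 * s.real 1 ≤ s.real 3 * (1 + s'.nat 6)
  real : s'.real = s.real
  vec : s'.vec = s.vec
  mat : s'.mat = s.mat
  out : s'.out = s.out ++ s.cur.toList

theorem computes_finishProg (s : State ι) :
    Computes O finishProg s 40 s.Finished := by
  refine Computes.mono (Computes.seq (.of_exec (.setNat ..) rfl) fun s₁ h₁ =>
    Computes.seq (Q := fun s₂ => (s₂.nat 5 = s₁.nat 5 ∧ s₂.nat 6 = s₁.nat 6 ∧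
      s.nat 4 + 2 ≤ s.nat 5 ∨ s₂.nat 5 = s₁.nat 5 + s₁.nat 5 ∧ s₂.nat 6 = s₁.nat 6 + 1 ∧
      s.nat 5 < s.nat 4 + 2) ∧ (∀ r < 5, s₂.nat r = s₁.nat r) ∧ s₂.real = s₁.real ∧
      s₂.vec = s₁.vec ∧ s₂.mat = s₁.mat ∧ s₂.cur = s₁.cur ∧ s₂.out = s₁.out)
      (Computes.branch (fun hb => Computes.seq (.of_exec (.setNat ..) rfl)
        fun s₂ h₂ => .of_exec (.setNat ..) ?_) (fun hb => Computes.skip ?_)) fun s₂ h₂ =>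
    Computes.seq (.of_exec (.emit ..) rfl) fun s₃ h₃ =>
    Computes.branch (Q := s.Finished) (fun hb => .of_exec (.setNat ..) ?_)
      fun hb => Computes.skip ?_) ?_ fun _ h => h
  · subst h₁ h₂
    refine ⟨.inr ⟨by simp [NExpr.eval], by simp [NExpr.eval], ?_⟩, fun r hr => ?_,
      rfl, rfl, rfl, rfl, rfl⟩
    · simp [BExpr.holds, NExpr.eval] at hb
      omega
    · simp [show r ≠ 6 by omega, show r ≠ 5 by omega]
  · subst h₁
    refine ⟨.inl ⟨rfl, rfl, ?_⟩, fun _ _ => rfl, rfl, rfl, rfl, rfl, rfl⟩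
    simp [BExpr.holds, NExpr.eval] at hb
    omega
  · subst h₁ h₃
    obtain ⟨h56, hn, hr, hv, hm, hc, ho⟩ := h₂
    have h4 := hn 4 (by norm_num)
    simp only [Function.update_self, NExpr.eval] at h4
    refine ⟨fun r h => ?_, by simp [h4], by simpa using h56, .inl ?_, hr, hv, hm, ?_⟩
    · simp [show r ≠ 2 by omega, hn r (by omega), show r ≠ 4 by omega]
    · simpa [BExpr.holds, RExpr.eval, NExpr.eval, hr] using hb
    · simp [hc, ho]
  · subst h₁ h₃
    obtain ⟨h56, hn, hr, hv, hm, hc, ho⟩ := h₂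
    have h4 := hn 4 (by norm_num)
    simp only [Function.update_self, NExpr.eval] at h4
    refine ⟨fun r h => ?_, by simp [h4], by simpa using h56, .inr ⟨?_, ?_⟩, hr, hv, hm, ?_⟩
    · simp [hn r (by omega), show r ≠ 4 by omega]
    · simp [hn 2]
    · simpa [BExpr.holds, RExpr.eval, NExpr.eval, hr] using hb
    · simp [hc, ho]
  · simp [BExpr.cost, RExpr.cost, NExpr.cost]

/-- Processing of the constraint named last: the gradient is in vector `2`. -/
def updateProg : Prog := .seq dotProg (.seq outerProg finishProg)

theorem computes_updateProg {s : State ι} {m : ℕ} (hm : s.nat 0 = m) :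
    Computes O updateProg s (100 * (m + 1) ^ 2) fun s' => ∃ s₁ : State ι,
      s.SameBase s₁ ∧ s₁.Finished s' ∧ ∀ a < m, ∀ b < m, s'.mat 0 a b = s.mat 0 a b +
        (6 + (s.vec 2 a - ∑ i ∈ Finset.range m, s.vec 2 i * s.vec 0 i) / s.real 4) *
        (6 + (s.vec 2 b - ∑ i ∈ Finset.range m, s.vec 2 i * s.vec 0 i) / s.real 4) := by
  refine Computes.mono (Computes.seq (computes_dotProg hm) fun s₁ h₁ =>
    Computes.seq (computes_outerProg (m := m) ?_) fun s₂ h₂ => (computes_finishProg s₂).mono le_rfl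
      fun s₃ h₃ => ⟨s₂, h₁.1.trans h₂.1, h₃, fun a ha b hb => ?_⟩) ?_ fun _ h => h
  · rw [h₁.1.nat 0 (by norm_num) (by norm_num), hm]
  · nlinarith
  · rw [h₃.mat, h₂.2.2 a ha b hb, h₁.2.1]
    simp [State.upd, h₁.1.vec, h₁.2.2, h₁.1.real 4]

/-- Initialization: registers `5`, real registers `3`, `4`, and the matrix `n • 1` in matrix `0`. -/
def initProg : Prog :=
  .seq (.setNat 5 (.const 1)) <|
  .seq (.setReal 4 (.add (.add (.var 0) (.var 0)) (.var 1))) <|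
  -- When 2G < ε the threshold keeps its default 0, so the stopping test succeeds at the first cut.
  .seq (.branch (.realLt (.add (.var 0) (.var 0)) (.var 1)) .skip
    (.setReal 3 (.mul (.mul (.const 9) (.var 4)) (.ofNat (.var 0))))) <|
  forLoop 7 (.setMat 0 (.var 7) (.var 7) (.ofNat (.var 0)))

/-- The state after the initialization. -/
structure State.Initialized (s : State ι) (n : ℕ) (G ε : ℝ) : Prop where
  nat0 : s.nat 0 = n
  nat5 : s.nat 5 = 1
  nat : ∀ r, r ≠ 0 → r ≠ 5 → r ≠ 7 → s.nat r = 0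
  real1 : s.real 1 = ε
  real3 : s.real 3 = if 2 * G < ε then 0 else 9 * (2 * G + ε) * n
  real4 : s.real 4 = 2 * G + ε
  vec : s.vec = fun _ _ => 0
  out : s.out = []

theorem computes_initProg (G ε : ℝ) :
    Computes O initProg (State.input ι n G ε) (n * 12 + 33) fun s' =>
      s'.Initialized n G ε ∧ ∀ a < n, ∀ b < n, s'.mat 0 a b = if a = b then (n : ℝ) else 0 := by
  refine Computes.mono (Computes.seq (.of_exec (.setNat ..) rfl) fun s₁ h₁ =>
    Computes.seq (.of_exec (.setReal ..) rfl) fun s₂ h₂ =>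
    Computes.seq (Q := fun s' => s'.nat 7 = 0 ∧ s'.Initialized n G ε ∧ s'.mat = fun _ _ _ => 0)
      (Computes.branch (fun hb => Computes.skip ?_) (fun hb => .of_exec (.setReal ..) ?_))
      fun s₃ h₃ =>
    Computes.forLoop (c := 5) (m := n) (fun k s' => s'.nat 7 = k ∧ s'.Initialized n G ε ∧
      ∀ a < n, ∀ b < n, s'.mat 0 a b = if a = b ∧ a < k then (n : ℝ) else 0) ?_ ?_ ?_) ?_ ?_
  · subst h₁ h₂
    simp only [BExpr.holds, RExpr.eval, State.input] at hb
    simp at hb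
    refine ⟨by simp [State.input], ⟨by simp [State.input], by simp [NExpr.eval], ?_,
      by simp [State.input], ?_, by simp [State.input, RExpr.eval, two_mul], rfl, rfl⟩, rfl⟩
    · intro r h0 h5 _
      simp [State.input, h0, h5]
    · rw [if_pos (by linarith)]
      simp [State.input]
  · subst h₁ h₂
    simp only [BExpr.holds, RExpr.eval, State.input] at hb
    simp at hb
    refine ⟨by simp [State.input], ⟨by simp [State.input], by simp [NExpr.eval], ?_,
      by simp [State.input], ?_, by simp [State.input, RExpr.eval, two_mul], rfl, rfl⟩, rfl⟩
    · intro r h0 h5 _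
      simp [State.input, h0, h5]
    · rw [if_neg (by linarith)]
      simp [State.input, RExpr.eval, NExpr.eval, two_mul]
  · rintro k s' ⟨h7, h, -⟩
    exact ⟨h7, h.nat0⟩
  · rintro k s' hk ⟨h7, h, hA⟩
    refine Computes.of_exec (.setMat ..) ⟨h7, by simp, ⟨by simpa using h.nat0,
      by simpa using h.nat5, fun r h0 h5 hr => by simpa [hr] using h.nat r h0 h5 hr,
      h.real1, h.real3, h.real4, h.vec, h.out⟩, fun a ha b hb => ?_⟩
    simp only [RExpr.eval, NExpr.eval, h7, h.nat0, Function.update_self]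
    by_cases hak : a = k
    · subst hak
      by_cases hba : b = a
      · subst hba
        simp
      · simp [hba, Ne.symm hba, hA a ha b hb]
    · have : a < k + 1 ↔ a < k := by omega
      simp [hak, hA a ha b hb, this]
  · obtain ⟨h7, h, hA⟩ := h₃
    exact ⟨h7, h, by simp [hA]⟩
  · simp [BExpr.cost, RExpr.cost, NExpr.cost]; omega
  · rintro s' ⟨-, h, hA⟩
    refine ⟨h, fun a ha b hb => ?_⟩
    simp [hA a ha b hb, ha]

end RealRAM

/-! ### Regret of follow-the-leader for quadratic losses. -/

namespace RealRAM

open Matrix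

variable {n : ℕ}

theorem dotProduct_vecMulVec_mulVec (a x y : Fin n → ℝ) :
    x ⬝ᵥ (vecMulVec a a *ᵥ y) = (a ⬝ᵥ x) * (a ⬝ᵥ y) := by
  rw [vecMulVec_mulVec, dotProduct_smul, dotProduct_comm x a]
  simp

theorem det_add_vecMulVec {B : Matrix (Fin n) (Fin n) ℝ} (hB : B.PosDef) (a : Fin n → ℝ) :
    (B + vecMulVec a a).det = B.det * (1 + a ⬝ᵥ (B⁻¹ *ᵥ a)) := by
  have h := det_add_replicateCol_mul_replicateRow (ι := Unit) (A := B)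
    (isUnit_iff_ne_zero.2 hB.det_pos.ne') a a
  rw [vecMulVec_eq Unit, h, det_unique (n := Unit), Matrix.mul_assoc]
  congr 1

theorem PosSemidef.dotProduct_comm {A : Matrix (Fin n) (Fin n) ℝ} (hA : A.PosSemidef)
    (x y : Fin n → ℝ) : x ⬝ᵥ (A *ᵥ y) = y ⬝ᵥ (A *ᵥ x) := by
  have h : Aᵀ = A := by simpa [IsHermitian, conjTranspose_eq_transpose_of_trivial] using hA.1
  rw [dotProduct_mulVec, _root_.dotProduct_comm, ← mulVec_transpose, h]

theorem PosSemidef.add_smul_quad {A : Matrix (Fin n) (Fin n) ℝ} (hA : A.PosSemidef)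
    (x d : Fin n → ℝ) (t : ℝ) :
    (x + t • d) ⬝ᵥ (A *ᵥ (x + t • d)) =
      x ⬝ᵥ (A *ᵥ x) + 2 * t * (x ⬝ᵥ (A *ᵥ d)) + t ^ 2 * (d ⬝ᵥ (A *ᵥ d)) := by
  simp only [mulVec_add, mulVec_smul, add_dotProduct, dotProduct_add, smul_dotProduct,
    dotProduct_smul, smul_eq_mul, PosSemidef.dotProduct_comm hA d x]
  ring

/-- A Newton step lowers the potential by at most the gain in the log-determinant. -/
theorem neg_log_det_le {B : Matrix (Fin n) (Fin n) ℝ} (hB : B.PosDef) (a d : Fin n → ℝ) (c : ℝ) :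
    -c ^ 2 * Real.log ((B + vecMulVec a a).det / B.det) ≤
      2 * c * (a ⬝ᵥ d) + d ⬝ᵥ (B *ᵥ d) + (a ⬝ᵥ d) ^ 2 := by
  set q := a ⬝ᵥ (B⁻¹ *ᵥ a) with hq
  have hdet : B.det ≠ 0 := hB.det_pos.ne'
  have hu : IsUnit B.det := isUnit_iff_ne_zero.2 hdet
  have hBi : B *ᵥ (B⁻¹ *ᵥ a) = a := by
    rw [mulVec_mulVec, mul_nonsing_inv _ hu, one_mulVec]
  have hq0 : 0 ≤ q := by
    have := hB.inv.posSemidef.dotProduct_mulVec_nonneg a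
    simpa [hq] using this
  have h1 : 0 < 1 + q := by linarith
  rw [det_add_vecMulVec hB, mul_div_cancel_left₀ _ hdet]
  have hlog : q / (1 + q) ≤ Real.log (1 + q) := by
    have := Real.one_sub_inv_le_log_of_pos h1
    have e : 1 - (1 + q)⁻¹ = q / (1 + q) := by field_simp; ring
    linarith
  -- By Sherman–Morrison the right-hand side is minimal at d = -(c/(1+q)) B⁻¹a, with value -c²
  -- q/(1+q). Completing the square around this point leaves a `B`-form, nonnegative by `key`, and
  -- the square of s + cq/(1+q).
  have key := hB.posSemidef.dotProduct_mulVec_nonneg (d + (c / (1 + q)) • (B⁻¹ *ᵥ a))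
  simp only [star_trivial] at key
  rw [PosSemidef.add_smul_quad hB.posSemidef, hBi, _root_.dotProduct_comm d a,
    _root_.dotProduct_comm (B⁻¹ *ᵥ a) a, ← hq] at key
  set s := a ⬝ᵥ d
  have h2 : c ^ 2 * (q / (1 + q)) ≤ c ^ 2 * Real.log (1 + q) := by gcongr
  have h3 : (s + c * q / (1 + q)) ^ 2 - c ^ 2 * (q / (1 + q))
      = s ^ 2 + 2 * c * s - 2 * (c / (1 + q)) * s - (c / (1 + q)) ^ 2 * q := by
    field_simp; ring
  linarith [sq_nonneg (s + c * q / (1 + q))]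

/-- This is AM-GM for the eigenvalues: λ ≤ c exp(λ/c - 1), and the trace bound makes the exponents
sum to at most 0. -/
theorem det_le_pow {B : Matrix (Fin n) (Fin n) ℝ} (hB : B.PosDef) {c : ℝ} (hc : 0 < c)
    (htr : B.trace ≤ n * c) : B.det ≤ c ^ n := by
  have h1 : B.det = ∏ i, hB.1.eigenvalues i := by simpa using hB.1.det_eq_prod_eigenvalues
  have h2 : B.trace = ∑ i, hB.1.eigenvalues i := by simpa using hB.1.trace_eq_sum_eigenvalues
  have h3 : ∏ i, hB.1.eigenvalues i ≤ ∏ i, c * Real.exp (hB.1.eigenvalues i / c - 1) := by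
    refine Finset.prod_le_prod (fun i _ => (hB.eigenvalues_pos i).le) fun i _ => ?_
    have := Real.add_one_le_exp (hB.1.eigenvalues i / c - 1)
    rw [sub_add_cancel, div_le_iff₀ hc] at this
    linarith
  rw [h1]
  refine h3.trans ?_
  rw [Finset.prod_mul_distrib, ← Real.exp_sum]
  have h4 : ∑ i, (hB.1.eigenvalues i / c - 1) ≤ 0 := by
    rw [Finset.sum_sub_distrib, ← Finset.sum_div, ← h2]
    have : B.trace / c ≤ n := by rwa [div_le_iff₀ hc]
    simpa using this
  simpa using mul_le_mul_of_nonneg_left (Real.exp_le_one_iff.2 h4) (pow_pos hc n).le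

theorem add_smul_sub_mem_stdSimplex {x y : Fin n → ℝ} (hx : x ∈ stdSimplex ℝ (Fin n))
    (hy : y ∈ stdSimplex ℝ (Fin n)) {t : ℝ} (h0 : 0 ≤ t) (h1 : t ≤ 1) :
    x + t • (y - x) ∈ stdSimplex ℝ (Fin n) := by
  have := convex_stdSimplex ℝ (Fin n) hx hy (sub_nonneg.2 h1) h0 (by ring)
  convert this using 1
  module

/-- The minimum of a positive semidefinite form over the simplex is strong. -/
theorem quad_add_quad_sub_le_of_min {A : Matrix (Fin n) (Fin n) ℝ} (hA : A.PosSemidef) {x y : Fin n → ℝ}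
    (hx : x ∈ stdSimplex ℝ (Fin n)) (hy : y ∈ stdSimplex ℝ (Fin n))
    (hmin : ∀ z ∈ stdSimplex ℝ (Fin n), x ⬝ᵥ (A *ᵥ x) ≤ z ⬝ᵥ (A *ᵥ z)) :
    x ⬝ᵥ (A *ᵥ x) + (y - x) ⬝ᵥ (A *ᵥ (y - x)) ≤ y ⬝ᵥ (A *ᵥ y) := by
  set d := y - x with hd
  have hD : 0 ≤ d ⬝ᵥ (A *ᵥ d) := by simpa using hA.dotProduct_mulVec_nonneg d
  have hnn : 0 ≤ x ⬝ᵥ (A *ᵥ d) := by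
    by_contra! hneg
    set p := x ⬝ᵥ (A *ᵥ d)
    set D := d ⬝ᵥ (A *ᵥ d)
    have hpos : 0 < D - p := by linarith
    -- As p < 0 ≤ D, the step t = -p/(D - p) stays in the segment; it changes the form by 2tp + t²D
    -- = t(1 + t)p < 0.
    have ht0 : 0 < -p / (D - p) := div_pos (by linarith) hpos
    have ht1 : -p / (D - p) ≤ 1 := by rw [div_le_one hpos]; linarith
    have h := hmin _ (add_smul_sub_mem_stdSimplex hx hy ht0.le ht1)
    rw [← hd, PosSemidef.add_smul_quad hA] at h
    set t := -p / (D - p)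
    have e : t * (D - p) = -p := div_mul_cancel₀ _ hpos.ne'
    nlinarith [mul_pos ht0 ht0]
  have hxy : y = x + (1 : ℝ) • d := by simp [hd]
  conv_rhs => rw [hxy, PosSemidef.add_smul_quad hA]
  linarith

/-- `A` is `n • 1` plus `T` outer squares for which following the leader has small regret. -/
def RegretBound (T : ℕ) (A : Matrix (Fin n) (Fin n) ℝ) : Prop :=
  A.PosSemidef ∧ ∃ B : Matrix (Fin n) (Fin n) ℝ, B.PosDef ∧ B.trace ≤ n * (n + T) ∧
    (∀ d : Fin n → ℝ, ∑ i, d i = 0 → d ⬝ᵥ (A *ᵥ d) = d ⬝ᵥ (B *ᵥ d)) ∧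
    ∀ y ∈ stdSimplex ℝ (Fin n), 36 * (T - Real.log (B.det / (n : ℝ) ^ n)) ≤ y ⬝ᵥ (A *ᵥ y)

theorem regretBound_zero (hn : 1 ≤ n) :
    RegretBound 0 ((n : ℝ) • (1 : Matrix (Fin n) (Fin n) ℝ)) := by
  have hn' : (0 : ℝ) < n := by exact_mod_cast hn
  have hpd : ((n : ℝ) • (1 : Matrix (Fin n) (Fin n) ℝ)).PosDef := Matrix.PosDef.one.smul hn'
  refine ⟨hpd.posSemidef, _, hpd, by simp, fun _ _ => rfl, fun y _ => ?_⟩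
  have h := hpd.posSemidef.dotProduct_mulVec_nonneg y
  simp only [star_trivial] at h
  simpa [div_self (pow_pos hn' n).ne'] using h

/-- The all-ones part of w vanishes on differences of simplex points, so there A can be replaced by
B, which grows only by a aᵀ. Moving from the leader x to y costs at least the `B`-form of y - x, and
the new loss is (6 - a·y)². Together these exceed the old minimum by at least 36 minus 36 times the
gain in log det B. -/
theorem RegretBound.succ {T : ℕ} {A : Matrix (Fin n) (Fin n) ℝ} (h : RegretBound T A)
    (hn : 1 ≤ n) {x a : Fin n → ℝ} (hx : x ∈ stdSimplex ℝ (Fin n))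
    (hmin : ∀ z ∈ stdSimplex ℝ (Fin n), x ⬝ᵥ (A *ᵥ x) ≤ z ⬝ᵥ (A *ᵥ z))
    (hax : a ⬝ᵥ x = 0) (ha : ∀ i, |a i| ≤ 1) :
    RegretBound (T + 1) (A + vecMulVec (fun i => 6 - a i) (fun i => 6 - a i)) := by
  obtain ⟨hA, B, hB, htr, hAB, hreg⟩ := h
  have hn' : (0 : ℝ) < (n : ℝ) ^ n := pow_pos (by exact_mod_cast hn) n
  have hps : ∀ v : Fin n → ℝ, (vecMulVec v v).PosSemidef := fun v => by
    simpa using posSemidef_vecMulVec_self_star v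
  have hw : ∀ d : Fin n → ℝ, (fun i => 6 - a i) ⬝ᵥ d = 6 * ∑ i, d i - a ⬝ᵥ d := by
    intro d
    simp [dotProduct, sub_mul, Finset.sum_sub_distrib, Finset.mul_sum]
  have hB' : (B + vecMulVec a a).PosDef := hB.add_posSemidef (hps a)
  refine ⟨hA.add (hps _), B + vecMulVec a a, hB', ?_, ?_, ?_⟩
  · have : (vecMulVec a a).trace ≤ n := by
      rw [trace_vecMulVec, dotProduct]
      calc ∑ i, a i * a i ≤ ∑ _i : Fin n, (1 : ℝ) := by
            refine Finset.sum_le_sum fun i _ => ?_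
            have := abs_le.1 (ha i)
            nlinarith
        _ = n := by simp
    rw [trace_add]
    push_cast
    nlinarith
  · intro d hd
    simp only [add_mulVec, dotProduct_add, dotProduct_vecMulVec_mulVec, hAB d hd, hw, hd]
    ring
  · intro y hy
    have h1 := quad_add_quad_sub_le_of_min hA hx hy hmin
    have hd : ∑ i, (y - x) i = 0 := by
      simp [Finset.sum_sub_distrib, hy.2, hx.2]
    rw [hAB _ hd] at h1
    have h2 := hreg x hx
    -- The choice c = -6 reproduces the cross term -12 a·y of (6 - a·y)².
    have h3 := neg_log_det_le hB a (y - x) (-6)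
    have h4 : a ⬝ᵥ (y - x) = a ⬝ᵥ y := by rw [dotProduct_sub, hax, sub_zero]
    rw [h4, Real.log_div hB'.det_pos.ne' hB.det_pos.ne'] at h3
    rw [Real.log_div hB.det_pos.ne' hn'.ne'] at h2
    rw [Real.log_div hB'.det_pos.ne' hn'.ne', add_mulVec, dotProduct_add,
      dotProduct_vecMulVec_mulVec, hw, hy.2]
    push_cast
    nlinarith

/-- The trace bound gives det B ≤ (n + T)^n ≤ (n(1 + T))^n, so the potential is at most n log(1 +
T). -/
theorem RegretBound.le {T : ℕ} {A : Matrix (Fin n) (Fin n) ℝ} (h : RegretBound T A)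
    (hn : 1 ≤ n) {y : Fin n → ℝ} (hy : y ∈ stdSimplex ℝ (Fin n)) :
    36 * (T - n * Real.log (1 + T)) ≤ y ⬝ᵥ (A *ᵥ y) := by
  obtain ⟨-, B, hB, htr, -, hreg⟩ := h
  refine le_trans ?_ (hreg y hy)
  have hn1 : (1 : ℝ) ≤ n := by exact_mod_cast hn
  have hn0 : (0 : ℝ) < n := by linarith
  have hT : (0 : ℝ) ≤ T := T.cast_nonneg
  have hdet := det_le_pow hB (by positivity) htr
  have h1 : B.det / (n : ℝ) ^ n ≤ (1 + T) ^ n := by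
    rw [div_le_iff₀ (by positivity), ← mul_pow]
    refine hdet.trans (pow_le_pow_left₀ (by positivity) ?_ _)
    nlinarith
  have h2 := Real.log_le_log (div_pos hB.det_pos (by positivity)) h1
  rw [Real.log_pow] at h2
  linarith

/-! ### Scalar inequalities, the simplex and tangents. -/

theorem one_add_le_exp_sub_sq {z : ℝ} (hz : |z| ≤ 1 / 2) : 1 + z ≤ Real.exp (z - z ^ 2 / 4) := by
  obtain ⟨h1, h2⟩ := abs_le.1 hz
  -- With v = z - z²/4, use 1 + v + v²/2 ≤ exp v and v ≥ 7z/8 for z ≥ 0, and (1 + v/2)² ≤ exp v for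
  -- z ≤ 0.
  rcases le_total 0 z with h | h
  · have h3 := Real.quadratic_le_exp_of_nonneg (x := z - z ^ 2 / 4) (by nlinarith)
    refine le_trans ?_ h3
    have h4 : z * (7 / 8) ≤ z - z ^ 2 / 4 := by nlinarith
    have h5 : (z * (7 / 8)) ^ 2 ≤ (z - z ^ 2 / 4) ^ 2 := pow_le_pow_left₀ (by linarith) h4 2
    nlinarith
  · have h3 := Real.add_one_le_exp ((z - z ^ 2 / 4) / 2)
    have h4 : Real.exp (z - z ^ 2 / 4) = Real.exp ((z - z ^ 2 / 4) / 2) ^ 2 := by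
      rw [← Real.exp_nat_mul]; congr 1; push_cast; ring
    have h5 : ((z - z ^ 2 / 4) / 2 + 1) ^ 2 ≤ Real.exp ((z - z ^ 2 / 4) / 2) ^ 2 :=
      pow_le_pow_left₀ (by nlinarith) h3 2
    rw [h4]
    refine le_trans ?_ h5
    nlinarith [sq_nonneg z, mul_nonneg (sq_nonneg z) (neg_nonneg.2 h)]

/-- The logarithm of `1 + u / ρ` lies below a parabola that does not depend on `ρ`, up to scale. -/
theorem add_le_mul_exp {ρ u : ℝ} (h1 : 17 / 10 ≤ ρ) (h2 : ρ ≤ 3) (hu : |u| ≤ 3 / 4) :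
    ρ + u ≤ ρ * Real.exp (ρ⁻¹ * (3 - (6 - u) ^ 2 / 12)) := by
  have hρ : 0 < ρ := by linarith
  have hz : |ρ⁻¹ * u| ≤ 1 / 2 := by
    rw [abs_mul, abs_of_pos (inv_pos.2 hρ), inv_mul_le_iff₀ hρ]
    linarith
  have h3 : 1 / 3 ≤ ρ⁻¹ := by
    rw [one_div]; exact inv_anti₀ hρ h2
  -- The right side is (u - u²/12)/ρ, and ρ ≤ 3 makes u²/(12ρ) at most (u/ρ)²/4.
  have h4 : ρ⁻¹ * u - (ρ⁻¹ * u) ^ 2 / 4 ≤ ρ⁻¹ * (3 - (6 - u) ^ 2 / 12) := by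
    have : 0 ≤ ρ⁻¹ * u ^ 2 * (ρ⁻¹ - 1 / 3) :=
      mul_nonneg (mul_nonneg (by linarith) (sq_nonneg u)) (by linarith)
    nlinarith
  have h5 := (one_add_le_exp_sub_sq hz).trans (Real.exp_le_exp.2 h4)
  calc ρ + u = ρ * (1 + ρ⁻¹ * u) := by field_simp
    _ ≤ _ := by gcongr

/-- The cross terms are nonpositive, so the squared distance is at most 2; 3/2 is a rational bound
for √2. -/
theorem norm_sub_le_of_mem_simplex {x y : Vec n} (hx : x ∈ simplex n) (hy : y ∈ simplex n) :
    ‖y - x‖ ≤ 3 / 2 := by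
  have hs : ∀ z ∈ simplex n, ∑ i, (z i) ^ 2 ≤ 1 := by
    intro z hz
    calc ∑ i, (z i) ^ 2 ≤ ∑ i, z i := by
          refine Finset.sum_le_sum fun i _ => ?_
          have h0 : 0 ≤ z i := hz.1 i
          have h1 : z i ≤ 1 := by
            have := Finset.single_le_sum (f := fun i => z i) (fun i _ => hz.1 i) (Finset.mem_univ i)
            exact this.trans hz.2.le
          nlinarith
      _ = 1 := hz.2
  rw [EuclideanSpace.norm_eq, Real.sqrt_le_left (by norm_num)]
  calc ∑ i, ‖(y - x) i‖ ^ 2 ≤ ∑ i, (y i ^ 2 + x i ^ 2) := by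
        refine Finset.sum_le_sum fun i _ => ?_
        have h0 : 0 ≤ y i := hy.1 i
        have h1 : 0 ≤ x i := hx.1 i
        simp only [Real.norm_eq_abs, sq_abs, PiLp.sub_apply]
        nlinarith [mul_nonneg h0 h1]
    _ ≤ (3 / 2) ^ 2 := by
        rw [Finset.sum_add_distrib]
        linarith [hs x hx, hs y hy]

/-- A convex differentiable function lies above its tangents. -/
theorem gradient_inner_le {g : Vec n → ℝ} (hg : ConvexOn ℝ (simplex n) g) {x y : Vec n}
    (hx : x ∈ simplex n) (hy : y ∈ simplex n) (hd : DifferentiableAt ℝ g x) :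
    g x + inner ℝ (gradient g x) (y - x) ≤ g y := by
  have hconv : ConvexOn ℝ (Set.Icc 0 1) fun t : ℝ => g (AffineMap.lineMap x y t) := by
    refine (hg.comp_affineMap (AffineMap.lineMap x y)).subset (fun t ht => ?_) (convex_Icc 0 1)
    exact hg.1.lineMap_mem hx hy ht
  have hin : inner ℝ (gradient g x) (y - x) = fderiv ℝ g x (y - x) := by
    simp [gradient]
  have hder : HasDerivAt (fun t : ℝ => g (AffineMap.lineMap x y t)) (fderiv ℝ g x (y - x)) 0 := by
    have h1 : HasFDerivAt g (fderiv ℝ g x) (AffineMap.lineMap x y (0 : ℝ)) := by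
      simpa using hd.hasFDerivAt
    exact h1.comp_hasDerivAt (0 : ℝ) AffineMap.hasDerivAt_lineMap
  have := hconv.le_slope_of_hasDerivAt (by simp) (by simp) zero_lt_one hder
  simp only [slope_def_field, AffineMap.lineMap_apply_one, AffineMap.lineMap_apply_zero, sub_zero,
    div_one] at this
  linarith

end RealRAM

/-! ### From cuts to the dual proof, and the number of rounds. -/

namespace RealRAM

open Matrix

variable {n : ℕ} {ι : Type*}

/-- The coefficients of the cut at `x` with gradient `h`. -/
noncomputable def cutVec (h x : Vec n) (ω : ℝ) (i : Fin n) : ℝ :=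
  -((h i - h.ofLp ⬝ᵥ x.ofLp) / ω)

/-- Coordinates of y sum to 1, so subtracting ⟨h, x⟩ from every coefficient turns the affine
function ⟨h, y - x⟩ into a linear form. -/
theorem cutVec_dotProduct (h x : Vec n) (ω : ℝ) {y : Vec n} (hy : y ∈ simplex n) :
    cutVec h x ω ⬝ᵥ y.ofLp = -(inner ℝ h (y - x) / ω) := by
  have h1 : inner ℝ h (y - x) = h.ofLp ⬝ᵥ y.ofLp - h.ofLp ⬝ᵥ x.ofLp := by
    rw [EuclideanSpace.inner_eq_star_dotProduct, WithLp.ofLp_sub, sub_dotProduct]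
    simp [dotProduct_comm]
  rw [h1]
  have h2 : ∑ i, y.ofLp i = 1 := hy.2
  have h3 : cutVec h x ω = (-ω⁻¹) • (h.ofLp - fun _ => h.ofLp ⬝ᵥ x.ofLp) := by
    ext i
    simp [cutVec]
    ring
  have h4 : (fun _ => h.ofLp ⬝ᵥ x.ofLp) ⬝ᵥ y.ofLp = h.ofLp ⬝ᵥ x.ofLp := by
    conv_lhs => rw [dotProduct]
    rw [← Finset.mul_sum, h2, mul_one]
  rw [h3, smul_dotProduct, sub_dotProduct, h4, smul_eq_mul]
  ring

theorem abs_cutVec_dotProduct_le {h x : Vec n} {G ε : ℝ} (hG : 0 ≤ G) (hε : 0 < ε)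
    (hh : ‖h‖ ≤ G) (hx : x ∈ simplex n) {y : Vec n} (hy : y ∈ simplex n) :
    |cutVec h x (2 * G + ε) ⬝ᵥ y.ofLp| ≤ 3 / 4 := by
  have hω : 0 < 2 * G + ε := by linarith
  rw [cutVec_dotProduct h x _ hy, abs_neg, abs_div, abs_of_pos hω, div_le_iff₀ hω]
  have h1 := abs_real_inner_le_norm h (y - x)
  have h2 := norm_sub_le_of_mem_simplex hx hy
  have h3 : ‖h‖ * ‖y - x‖ ≤ G * (3 / 2) := mul_le_mul hh h2 (norm_nonneg _) hG
  linarith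

/-- An entry of the cut is its value at a vertex of the simplex. -/
theorem abs_cutVec_le {h x : Vec n} {G ε : ℝ} (hG : 0 ≤ G) (hε : 0 < ε)
    (hh : ‖h‖ ≤ G) (hx : x ∈ simplex n) (i : Fin n) : |cutVec h x (2 * G + ε) i| ≤ 1 := by
  have h1 := abs_cutVec_dotProduct_le hG hε hh hx
    (y := WithLp.toLp 2 (Pi.single i 1)) (single_mem_stdSimplex ℝ i)
  rw [dotProduct_single_one] at h1
  linarith

/-- An upper bound for the dual objective in terms of the quadratic form of `A`. -/
def DualBound (f : ι → Vec n → ℝ) (ε ω : ℝ) (L : List ι) (A : Matrix (Fin n) (Fin n) ℝ) : Prop :=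
  ∀ y ∈ simplex n, (L.map fun j => max 0 (Real.exp 1 - f j y / ω)).prod ≤
    (Real.exp 1 - ε / ω) ^ L.length *
      Real.exp ((Real.exp 1 - ε / ω)⁻¹ * (3 * L.length - (y.ofLp ⬝ᵥ (A *ᵥ y.ofLp) - n) / 12))

theorem exp_one_sub_bounds {G ε : ℝ} (hG : 0 ≤ G) (hε : 0 < ε) :
    17 / 10 ≤ Real.exp 1 - ε / (2 * G + ε) ∧ Real.exp 1 - ε / (2 * G + ε) ≤ 3 := by
  have h1 := Real.exp_one_gt_d9
  have h2 := Real.exp_one_lt_d9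
  have hω : 0 < 2 * G + ε := by linarith
  have h3 : ε / (2 * G + ε) ≤ 1 := by rw [div_le_one hω]; linarith
  have h4 : 0 < ε / (2 * G + ε) := div_pos hε hω
  constructor <;> linarith

/-- The regularizer contributes n‖y‖² ≤ n on the simplex, which the term -n in `DualBound` absorbs.
-/
theorem dualBound_nil (f : ι → Vec n → ℝ) {G ε : ℝ} (hG : 0 ≤ G) (hε : 0 < ε) :
    DualBound f ε (2 * G + ε) [] ((n : ℝ) • (1 : Matrix (Fin n) (Fin n) ℝ)) := by
  intro y hy
  obtain ⟨h1, -⟩ := exp_one_sub_bounds hG hε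
  have h2 : y.ofLp ⬝ᵥ y.ofLp ≤ 1 := by
    calc ∑ i, y i * y i ≤ ∑ i, y i := by
          refine Finset.sum_le_sum fun i _ => ?_
          have h0 : 0 ≤ y i := hy.1 i
          have h1 : y i ≤ 1 :=
            (Finset.single_le_sum (f := fun i => y i) (fun i _ => hy.1 i)
              (Finset.mem_univ i)).trans hy.2.le
          nlinarith
      _ = 1 := hy.2
  have h3 : (n : ℝ) * (y.ofLp ⬝ᵥ y.ofLp) ≤ n * 1 := by gcongr
  simp only [List.map_nil, List.prod_nil, List.length_nil, pow_zero, one_mul, Nat.cast_zero,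
    mul_zero, smul_mulVec, one_mulVec, dotProduct_smul, smul_eq_mul]
  apply Real.one_le_exp
  apply mul_nonneg (inv_nonneg.2 (by linarith))
  linarith

/-- The tangent at x and f_j(x) > ε bound the new factor by ρ + u, and `add_le_mul_exp` bounds this
by the exponential of the new quadratic loss. -/
theorem DualBound.append {f : ι → Vec n → ℝ} {G ε : ℝ} (hG : 0 ≤ G) (hε : 0 < ε) {L : List ι}
    {A : Matrix (Fin n) (Fin n) ℝ} (hL : DualBound f ε (2 * G + ε) L A) {j : ι}
    (hconv : ConvexOn ℝ (simplex n) (f j)) {x : Vec n} (hx : x ∈ simplex n)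
    (hd : DifferentiableAt ℝ (f j) x) (hg : ‖gradient (f j) x‖ ≤ G) (hj : ε < f j x) :
    DualBound f ε (2 * G + ε) (L ++ [j])
      (A + vecMulVec (fun i => 6 - cutVec (gradient (f j) x) x (2 * G + ε) i)
        (fun i => 6 - cutVec (gradient (f j) x) x (2 * G + ε) i)) := by
  intro y hy
  have hω : 0 < 2 * G + ε := by linarith
  obtain ⟨h1, h2⟩ := exp_one_sub_bounds hG hε
  set ρ := Real.exp 1 - ε / (2 * G + ε) with hρ
  have hu := abs_cutVec_dotProduct_le hG hε hg hx hy
  have hf : Real.exp 1 - f j y / (2 * G + ε) ≤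
      ρ + cutVec (gradient (f j) x) x (2 * G + ε) ⬝ᵥ y.ofLp := by
    rw [cutVec_dotProduct _ _ _ hy, hρ]
    have h3 := gradient_inner_le hconv hx hy hd
    have h4 : (ε + inner ℝ (gradient (f j) x) (y - x)) / (2 * G + ε) ≤ f j y / (2 * G + ε) := by
      gcongr
      linarith
    rw [add_div] at h4
    linarith
  have hw : (fun i => 6 - cutVec (gradient (f j) x) x (2 * G + ε) i) ⬝ᵥ y.ofLp =
      6 - cutVec (gradient (f j) x) x (2 * G + ε) ⬝ᵥ y.ofLp := by
    have : ∑ i, y.ofLp i = 1 := hy.2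
    conv_lhs => rw [dotProduct]
    simp only [sub_mul, Finset.sum_sub_distrib, ← Finset.mul_sum, this, mul_one]
    rfl
  rw [add_mulVec, dotProduct_add, dotProduct_vecMulVec_mulVec, hw]
  set u := cutVec (gradient (f j) x) x (2 * G + ε) ⬝ᵥ y.ofLp
  have hmax : max 0 (Real.exp 1 - f j y / (2 * G + ε)) ≤
      ρ * Real.exp (ρ⁻¹ * (3 - (6 - u) ^ 2 / 12)) := by
    refine max_le (by positivity) (hf.trans (add_le_mul_exp h1 h2 hu))
  rw [List.map_append, List.prod_append, List.length_append]
  simp only [List.map_cons, List.map_nil, List.prod_singleton, List.length_singleton]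
  refine (mul_le_mul (hL y hy) hmax (le_max_left _ _) (by positivity)).trans_eq ?_
  rw [pow_succ, mul_mul_mul_comm, ← Real.exp_add]
  congr 2
  push_cast
  ring

/-- Each factor ρ lies below e by a relative amount of order ε/ω. The test on T says that T such
gains outweigh the regret. -/
theorem isDualProof_of_bounds {f : ι → Vec n → ℝ} {G ε : ℝ} (hG : 0 ≤ G) (hε : 0 < ε)
    (hn : 1 ≤ n) {L : List ι} {A : Matrix (Fin n) (Fin n) ℝ} (hL : DualBound f ε (2 * G + ε) L A)
    (hA : RegretBound L.length A) {m : ℕ} (hm : L.length + 1 ≤ 2 ^ m)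
    (hT : 9 * (2 * G + ε) * n * (1 + m) < L.length * ε) : IsDualProof f (2 * G + ε) L := by
  have hω : 0 < 2 * G + ε := by linarith
  refine ⟨hω, fun y hy => (hL y hy).trans_lt ?_⟩
  obtain ⟨h1, h2⟩ := exp_one_sub_bounds hG hε
  have hA' := hA.le hn (y := y.ofLp) hy
  set T := (L.length : ℝ) with hTdef
  have hn0 : (0 : ℝ) < n := by exact_mod_cast hn
  have hT0 : 0 ≤ T := L.length.cast_nonneg
  have hm0 : (0 : ℝ) ≤ m := m.cast_nonneg
  have hlog : Real.log (1 + T) ≤ m := by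
    have h3 : 1 + T ≤ 2 ^ m := by rw [hTdef, add_comm]; exact_mod_cast hm
    have h4 := Real.log_le_log (by linarith) h3
    rw [Real.log_pow] at h4
    nlinarith [Real.log_two_lt_d9]
  -- With v = ε/(3ω): exp(1 - v) ≥ e(1 - v) ≥ e - 3v, because e ≤ 3.
  have hρ : Real.exp 1 - ε / (2 * G + ε) ≤ Real.exp (1 - ε / (3 * (2 * G + ε))) := by
    have h3 := Real.add_one_le_exp (-(ε / (3 * (2 * G + ε))))
    have h4 : Real.exp (1 - ε / (3 * (2 * G + ε))) =
        Real.exp 1 * Real.exp (-(ε / (3 * (2 * G + ε)))) := by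
      rw [← Real.exp_add]; congr 1
    have h5 : ε / (2 * G + ε) = 3 * (ε / (3 * (2 * G + ε))) := by field_simp
    have h6 : 0 < ε / (3 * (2 * G + ε)) := by positivity
    rw [h4, h5]
    nlinarith [Real.exp_one_lt_d9, Real.exp_one_gt_d9]
  set ρ := Real.exp 1 - ε / (2 * G + ε)
  have hκ : ρ⁻¹ ≤ 1 := inv_le_one_of_one_le₀ (by linarith)
  have hκ0 : 0 < ρ⁻¹ := inv_pos.2 (by linarith)
  set z := 3 * T - (y.ofLp ⬝ᵥ (A *ᵥ y.ofLp) - n) / 12 with hz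
  -- The regret bound leaves 3n log(1 + T) + n/12, and log(1 + T) ≤ m.
  have hz1 : z ≤ 3 * (n * (m + 1)) := by
    have := mul_le_mul_of_nonneg_left hlog hn0.le
    rw [hz]
    linarith
  have hz2 : ρ⁻¹ * z ≤ 3 * (n * (m + 1)) := by
    calc ρ⁻¹ * z ≤ ρ⁻¹ * (3 * (n * (m + 1))) := by gcongr
      _ ≤ 1 * (3 * (n * (m + 1))) := by gcongr
      _ = _ := one_mul _
  calc ρ ^ L.length * Real.exp (ρ⁻¹ * z)
      ≤ Real.exp (1 - ε / (3 * (2 * G + ε))) ^ L.length * Real.exp (ρ⁻¹ * z) := by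
        have : 0 ≤ ρ := by linarith
        gcongr
    _ = Real.exp (T * (1 - ε / (3 * (2 * G + ε))) + ρ⁻¹ * z) := by
        rw [← Real.exp_nat_mul, ← Real.exp_add]
    _ < Real.exp (T * 1) := by
        apply Real.exp_lt_exp.2
        have : 3 * (n * (m + 1)) < T * (ε / (3 * (2 * G + ε))) := by
          rw [← mul_div_assoc, lt_div_iff₀ (by positivity)]
          linarith
        linarith
    _ = Real.exp 1 ^ L.length := by rw [Real.exp_nat_mul]

/-- A constraint varies by at most 3G/2 below its value at x, which is less than ε; so f_j > 0
everywhere and the single factor is below e. -/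
theorem isDualProof_singleton {f : ι → Vec n → ℝ} {G ε : ℝ} (hG : 0 ≤ G) (hε : 0 < ε)
    (hGε : 2 * G < ε) {j : ι} (hconv : ConvexOn ℝ (simplex n) (f j)) {x : Vec n}
    (hx : x ∈ simplex n) (hd : DifferentiableAt ℝ (f j) x) (hg : ‖gradient (f j) x‖ ≤ G)
    (hj : ε < f j x) : IsDualProof f (2 * G + ε) [j] := by
  have hω : 0 < 2 * G + ε := by linarith
  refine ⟨hω, fun y hy => ?_⟩
  have h1 := gradient_inner_le hconv hx hy hd
  have h2 := (abs_le.1 (abs_real_inner_le_norm (gradient (f j) x) (y - x))).1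
  have h3 : ‖gradient (f j) x‖ * ‖y - x‖ ≤ G * (3 / 2) :=
    mul_le_mul hg (norm_sub_le_of_mem_simplex hx hy) (norm_nonneg _) hG
  have h4 : 0 < f j y / (2 * G + ε) := div_pos (by linarith) hω
  simpa using ⟨Real.exp_pos 1, h4⟩

/-- The inequality behind the bound on the number of oracle calls. -/
theorem count_le_of_le_log {N T : ℝ} {m : ℕ} (hN : 0 ≤ N) (hT : 0 ≤ T)
    (hm : (2 : ℝ) ^ m ≤ 2 * (T + 1)) (h : T ≤ 36 * N * (1 + m)) :
    T + 1 ≤ 1000 * (1 + N) * Real.log (2 + N) := by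
  have hl2 := Real.log_two_gt_d9
  have hl2' := Real.log_two_lt_d9
  have hℓ : Real.log 2 ≤ Real.log (2 + N) := Real.log_le_log (by norm_num) (by linarith)
  set ℓ := Real.log (2 + N) with hℓdef
  -- A bootstrap: log(1 + T) = 2 log r ≤ 2(r - 1) turns the hypothesis into r² - 1 ≤ 108 N r, hence
  -- r ≤ 1 + 108N. This crude bound gives log r ≤ 8ℓ, which is fed back into the hypothesis.
  set r := Real.sqrt (1 + T) with hr
  have hr2 : r ^ 2 = 1 + T := Real.sq_sqrt (by linarith)
  have hr1 : 1 ≤ r := by rw [hr]; exact Real.one_le_sqrt.2 (by linarith)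
  have hlogT : Real.log (1 + T) = 2 * Real.log r := by rw [← hr2, Real.log_pow]; norm_num
  have hm1 : m * Real.log 2 ≤ Real.log 2 + 2 * Real.log r := by
    have := Real.log_le_log (by positivity) hm
    rw [Real.log_pow, Real.log_mul (by norm_num) (by positivity), add_comm T, hlogT] at this
    exact this
  have hr0 : 0 ≤ Real.log r := Real.log_nonneg hr1
  have hm2 : (m : ℝ) ≤ 1 + 3 * Real.log r := by
    nlinarith
  have hr3 : Real.log r ≤ r - 1 := Real.log_le_sub_one_of_pos (by linarith)
  have hr4 : r ≤ 1 + 108 * N := by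
    by_contra! hc
    have h1 : T ≤ 36 * N * (3 * r) :=
      h.trans (mul_le_mul_of_nonneg_left (by linarith) (by linarith))
    nlinarith
  have hr5 : Real.log r ≤ 8 * ℓ := by
    have h1 := Real.log_le_log (by linarith) (show r ≤ 2 ^ 7 * (2 + N) by linarith)
    rw [Real.log_mul (by norm_num) (by linarith), Real.log_pow, ← hℓdef] at h1
    norm_num at h1
    linarith
  have h2 : T ≤ 36 * N * (27 * ℓ) :=
    h.trans (mul_le_mul_of_nonneg_left (by linarith) (by linarith))
  nlinarith [mul_nonneg hN (show (0 : ℝ) ≤ ℓ by linarith)]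

end RealRAM

/-! ### Traces, the loop invariant and the whole run. -/

namespace RealRAM

open Matrix

variable {n : ℕ} {ι : Type*}

theorem steps_count_of_ne (k : ℕ) {e : Event} (he : e ≠ .step) : (steps k).count e = 0 := by
  simp [steps, List.count_replicate, he.symm]

theorem steps_count (k : ℕ) : (steps k).count .step = k := by
  simp [steps]

/-- An infix that avoids a letter lies on one side of each occurrence of this letter. -/
theorem infix_append_cons {α : Type*} {e : α} {block pre rest : List α}
    (h : block <:+: pre ++ e :: rest) (he : e ∉ block) : block <:+: pre ∨ block <:+: rest := by
  obtain ⟨l, r, h⟩ := h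
  rcases List.append_eq_append_iff.1 h with ⟨a, h1, -⟩ | ⟨c, h1, h2⟩
  · exact .inl ⟨l, a, h1.symm⟩
  cases c with
  | nil => exact .inl ⟨l, [], by simpa using h1⟩
  | cons b c =>
    obtain ⟨rfl, rfl⟩ : e = b ∧ rest = c ++ r := by simpa using h2
    rcases List.append_eq_append_iff.1 h1 with ⟨a, -, h3⟩ | ⟨d, h3, h4⟩
    · exact absurd (by simp [h3]) he
    · cases d with
      | nil => exact absurd (h4 ▸ List.mem_cons_self : e ∈ [] ++ block) he
      | cons b d =>
        obtain ⟨-, rfl⟩ : e = b ∧ c = d ++ block := by simpa using h4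
        exact .inr ⟨d, r, rfl⟩

/-- At most `k` elementary steps and at most `g` gradient computations and `p` projections. -/
structure Small (k g p : ℕ) (t : List Event) : Prop where
  step : t.count .step ≤ k
  gradient : t.count .gradient ≤ g
  project : t.count .project ≤ p

theorem Small.append {k g p k' g' p' : ℕ} {t t' : List Event} (h : Small k g p t)
    (h' : Small k' g' p' t') : Small (k + k') (g + g') (p + p') (t ++ t') where
  step := by rw [List.count_append]; exact add_le_add h.step h'.step
  gradient := by rw [List.count_append]; exact add_le_add h.gradient h'.gradient
  project := by rw [List.count_append]; exact add_le_add h.project h'.project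

theorem Small.sublist {k g p : ℕ} {t t' : List Event} (h : Small k g p t) (ht : t'.Sublist t) :
    Small k g p t' where
  step := (ht.count_le _).trans h.step
  gradient := (ht.count_le _).trans h.gradient
  project := (ht.count_le _).trans h.project

theorem Small.steps {k c : ℕ} (h : k ≤ c) : Small c 0 0 (steps k) where
  step := by rwa [steps_count]
  gradient := by rw [steps_count_of_ne _ (by decide)]
  project := by rw [steps_count_of_ne _ (by decide)]

/-- All blocks between separation calls are small, also after a small block without projection. -/
def SmallBlocks (k : ℕ) (t : List Event) : Prop :=
  ∀ pre, Small k 1 0 pre → ∀ block, block <:+: pre ++ t → Event.separate ∉ block →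
    Small (k + 3) 1 1 block

theorem SmallBlocks.steps (k : ℕ) : SmallBlocks k (steps 3) := fun _ hpre _ hb _ => by
  have h := (hpre.append (Small.steps (le_refl 3))).sublist hb.sublist
  exact ⟨h.step, h.gradient, h.project.trans (by norm_num)⟩

/-- A block without separation call lies before the call, in the prefix followed by loop test and
projection, or after it, where `rest` becomes the prefix of `t`. The quantifier over prefixes exists
for this induction. -/
theorem SmallBlocks.cons {k : ℕ} {rest t : List Event} (h : SmallBlocks k t)
    (hrest : Small k 1 0 rest) :
    SmallBlocks k (RealRAM.steps 3 ++ (Event.project :: Event.separate :: rest) ++ t) := by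
  intro pre hpre block hb he
  have e : pre ++ (RealRAM.steps 3 ++ (Event.project :: Event.separate :: rest) ++ t) =
      (pre ++ RealRAM.steps 3 ++ [Event.project]) ++ Event.separate :: (rest ++ t) := by simp
  rw [e] at hb
  rcases infix_append_cons hb he with hb | hb
  · have hp : Small 0 0 1 [Event.project] := ⟨by decide, by decide, by decide⟩
    exact ((hpre.append (Small.steps (le_refl 3))).append hp).sublist hb.sublist
  · exact h rest hrest block hb he

/-- One iteration: project the zero vector, separate, and process the answer. -/
def bodyProg : Prog :=
  .seq (.project 1 0 0) <| .seq (.separate 0 3) <|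
    .branch (.natLt (.var 3) (.const 1)) (.seq (.setNat 1 (.const 1)) (.setNat 2 (.const 1)))
      (.seq (.gradient 0 2) updateProg)

/-- The whole program. -/
def mainProg : Prog := .seq initProg (.loop (.natLt (.var 2) (.const 1)) bodyProg)

/-- The assumptions on the family of constraints and on the oracles. -/
structure ValidInstance (f : ι → Vec n → ℝ) (G ε : ℝ) (O : Oracles n ι) : Prop where
  one_le : 1 ≤ n
  nonneg : 0 ≤ G
  pos : 0 < ε
  convex : ∀ j, ConvexOn ℝ (simplex n) (f j)
  diff : ∀ j, ∀ x ∈ simplex n, DifferentiableAt ℝ (f j) x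
  bound : ∀ j, ∀ x ∈ simplex n, ‖gradient (f j) x‖ ≤ G
  separate : IsSeparationOracle f ε O.separate
  grad : O.gradient = fun j x => _root_.gradient (f j) x
  project : IsGeneralizedProjection O.project

/-- The threshold that the program uses. -/
noncomputable def threshold (n : ℕ) (G ε : ℝ) : ℝ :=
  if 2 * G < ε then 0 else 9 * (2 * G + ε) * n

/-- The invariant after `T` iterations. -/
structure LoopInv (f : ι → Vec n → ℝ) (G ε : ℝ) (T : ℕ) (s : State ι) : Prop where
  nat0 : s.nat 0 = n
  nat1 : s.nat 1 = 0
  nat2 : s.nat 2 = 0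
  nat4 : s.nat 4 = T
  nat5 : s.nat 5 = 2 ^ s.nat 6
  lower : T + 1 ≤ s.nat 5
  upper : s.nat 5 ≤ 2 * (T + 1)
  real1 : s.real 1 = ε
  real3 : s.real 3 = threshold n G ε
  real4 : s.real 4 = 2 * G + ε
  vec : ∀ i < n, s.vec 1 i = 0
  regret : RegretBound T (s.getMat n 0)
  length : s.out.length = T
  dual : DualBound f ε (2 * G + ε) s.out (s.getMat n 0)
  notDone : T = 0 ∨ T * ε ≤ threshold n G ε * (1 + s.nat 6)

variable {f : ι → Vec n → ℝ} {G ε : ℝ} {O : Oracles n ι}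

/-- The last failed test bounds T. If ε ≤ 2G, then ω ≤ 4G and it reads T ≤ 36(nG/ε)(1 + m); if 2G <
ε, threshold 0 forces T = 0. The extra 1 pays for the call of the coming round. -/
theorem LoopInv.count_le (hO : ValidInstance f G ε O) {T : ℕ} {s : State ι}
    (h : LoopInv f G ε T s) :
    (T : ℝ) + 1 ≤ 1500 * (1 + n * G / ε) * Real.log (2 + n * G / ε) := by
  have hG := hO.nonneg
  have hε := hO.pos
  have hN : 0 ≤ n * G / ε := by positivity
  have hl : Real.log 2 ≤ Real.log (2 + n * G / ε) := Real.log_le_log (by norm_num) (by linarith)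
  have hl2 := Real.log_two_gt_d9
  have h0 : (1 : ℝ) ≤ 1500 * (1 + n * G / ε) * Real.log (2 + n * G / ε) := by
    nlinarith
  rcases h.notDone with rfl | hT
  · simpa using h0
  rw [threshold] at hT
  split_ifs at hT with hGε
  · have : (T : ℝ) ≤ 0 := by
      by_contra! hc
      nlinarith
    linarith
  · have h5 : (2 : ℝ) ^ s.nat 6 ≤ 2 * (T + 1) := by
      have := h.upper
      rw [h.nat5] at this
      exact_mod_cast this
    have h6 : (T : ℝ) ≤ 36 * (n * G / ε) * (1 + s.nat 6) := by
      have e : 36 * (n * G / ε) * (1 + s.nat 6) = 36 * (n * G) * (1 + s.nat 6) / ε := by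
        field_simp
      rw [e, le_div_iff₀ hε]
      refine hT.trans ?_
      gcongr ?_ * _
      have : 9 * (2 * G + ε) * n ≤ 9 * (4 * G) * n := by gcongr; linarith
      linarith
    have h7 := count_le_of_le_log hN T.cast_nonneg h5 h6
    nlinarith

/-- One iteration keeps the invariant or ends with a correct answer. -/
theorem exec_bodyProg (hO : ValidInstance f G ε O) {T : ℕ} {s : State ι}
    (h : LoopInv f G ε T s) : ∃ rest s', Exec O bodyProg s
      (Event.project :: Event.separate :: rest) s' ∧ Small (100 * (n + 1) ^ 2 + 40) 1 0 rest ∧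
      rest.count .separate = 0 ∧
      (s'.nat 2 = 1 ∧ s'.Correct f ε (2 * G + ε) ∨ LoopInv f G ε (T + 1) s') := by
  have hG := hO.nonneg
  have hε := hO.pos
  have hn := hO.one_le
  set A := s.getMat n 0 with hA
  set x := O.project (s.getVec n 1) A with hx
  -- Vector 1 is never written, so the projection minimizes yᵀAy itself.
  have hv1 : s.getVec n 1 = 0 := by
    ext i
    simpa [State.getVec] using h.vec i i.2
  obtain ⟨hxs, hxmin⟩ := hO.project (s.getVec n 1) A h.regret.1
  rw [← hx] at hxs hxmin
  have hmin : ∀ z ∈ stdSimplex ℝ (Fin n), x.ofLp ⬝ᵥ (A *ᵥ x.ofLp) ≤ z ⬝ᵥ (A *ᵥ z) := by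
    intro z hz
    have := hxmin (a := WithLp.toLp 2 z) hz
    simpa [hv1] using this
  have hproj := Exec.project (O := O) 1 0 0 s
  rw [← hA, ← hx] at hproj
  set s₁ := s.putVec 0 x with hs₁
  have hs₁x : s₁.getVec n 0 = x := by
    ext i
    simp [State.getVec, hs₁, State.putVec]
  have hs₁v : ∀ i < n, s₁.vec 1 i = 0 := by
    intro i hi
    simpa [hs₁, State.putVec] using h.vec i hi
  have hsep := Exec.separate (O := O) 0 3 s₁
  rw [hs₁x] at hsep
  cases hans : O.separate x with
  | none =>
    rw [hans] at hsep
    set s₂ := s₁.answer 3 none with hs₂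
    have h3 : s₂.nat 3 = 0 := by simp [hs₂, State.answer]
    have hb : (BExpr.natLt (.var 3) (.const 1)).holds s₂ := by
      simp [BExpr.holds, NExpr.eval, h3]
    have hexec := hproj.seq (hsep.seq (Exec.branchTrue (q := .seq (.gradient 0 2) updateProg) hb
      ((Exec.setNat 1 (.const 1) s₂).seq (Exec.setNat 2 (.const 1) _))))
    refine ⟨_, _, hexec, ?_, ?_, .inl ⟨by simp [NExpr.eval], .inl ⟨by simp [NExpr.eval], ?_⟩⟩⟩
    · have := Small.append (Small.steps (show 3 ≤ 100 * (n + 1) ^ 2 + 36 by omega))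
        (Small.append (Small.steps (le_refl 2)) (Small.steps (le_refl 2)))
      exact ⟨this.step, this.gradient.trans (by norm_num), this.project⟩
    · simp [List.count_append, steps_count_of_ne]
    · have : x ∈ simplex n ∧ ∀ j, f j x ≤ ε := ⟨hxs, (hO.separate x hxs).2 hans⟩
      have e : State.getVec s₂ n 0 = x := hs₁x
      rw [← e] at this
      exact this
  | some j =>
    rw [hans] at hsep
    have hj := (hO.separate x hxs).1 j hans
    set s₂ := s₁.answer 3 (some j) with hs₂
    have h3 : s₂.nat 3 = 1 := by simp [hs₂, State.answer]
    have hb : ¬ (BExpr.natLt (.var 3) (.const 1)).holds s₂ := by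
      simp [BExpr.holds, NExpr.eval, h3]
    have hgrad := Exec.gradient (O := O) 0 2 s₂
    set g := gradient (f j) x with hg
    have hs₃ : s₂.gradientStep O 0 2 = s₂.putVec 2 g := by
      have e : s₂.getVec n 0 = x := hs₁x
      have e' : s₂.cur = some j := rfl
      simp only [State.gradientStep, e', e, hO.grad, hg]
    rw [hs₃] at hgrad
    set s₃ := s₂.putVec 2 g with hs₃'
    have n3 : ∀ r, r ≠ 3 → s₃.nat r = s.nat r := by
      intro r hr
      simp [hs₃', hs₂, hs₁, State.putVec, State.answer, hr]
    obtain ⟨k, hk, s₅, he, s₄, h34, h45, hmat⟩ :=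
      computes_updateProg (O := O) (s := s₃) (m := n) (by rw [n3 0 (by norm_num), h.nat0])
    have hexec := hproj.seq (hsep.seq (Exec.branchFalse
      (p := .seq (.setNat 1 (.const 1)) (.setNat 2 (.const 1))) hb (hgrad.seq he)))
    have hgi : ∀ i : Fin n, s₃.vec 2 i = g i := by
      intro i
      simp [hs₃', State.putVec]
    have hxi : ∀ i : Fin n, s₃.vec 0 i = x i := by
      intro i
      simp [hs₃', hs₂, hs₁, State.putVec, State.answer]
    have hsum : ∑ i ∈ Finset.range n, s₃.vec 2 i * s₃.vec 0 i = g.ofLp ⬝ᵥ x.ofLp := by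
      rw [Finset.sum_range, dotProduct]
      exact Finset.sum_congr rfl fun i _ => by rw [hgi, hxi]
    have r3 : s₃.real = s.real := rfl
    have hA' : s₅.getMat n 0 = A + vecMulVec (fun i => 6 - cutVec g x (2 * G + ε) i)
        (fun i => 6 - cutVec g x (2 * G + ε) i) := by
      ext a b
      have hm := hmat a a.2 b b.2
      rw [hsum, hgi, hgi, r3, h.real4] at hm
      simp only [State.getMat, of_apply, hm, Matrix.add_apply, vecMulVec_apply, cutVec, sub_neg_eq_add]
      rfl
    have hout : s₅.out = s.out ++ [j] := by
      rw [h45.out, h34.out, h34.cur]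
      rfl
    have hreal : ∀ r, r ≠ 2 → s₅.real r = s.real r := fun r hr => by
      rw [h45.real, h34.real r hr, r3]
    have hnat : ∀ r, r ≠ 3 → r ≠ 7 → r ≠ 8 → s₄.nat r = s.nat r := fun r h3 h7 h8 => by
      rw [h34.nat r h7 h8, n3 r h3]
    have h4 : s₅.nat 4 = T + 1 := by
      rw [h45.nat4, hnat 4 (by norm_num) (by norm_num) (by norm_num), h.nat4]
    have h1 : s₅.nat 1 = 0 := by
      rw [h45.nat 1 (by norm_num), hnat 1 (by norm_num) (by norm_num) (by norm_num), h.nat1]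
    have hpow : s₅.nat 5 = 2 ^ s₅.nat 6 ∧ T + 1 + 1 ≤ s₅.nat 5 ∧ s₅.nat 5 ≤ 2 * (T + 1 + 1) := by
      have h56 := h45.nat56
      rw [hnat 4 (by norm_num) (by norm_num) (by norm_num),
        hnat 5 (by norm_num) (by norm_num) (by norm_num),
        hnat 6 (by norm_num) (by norm_num) (by norm_num), h.nat4] at h56
      have hl := h.lower
      have hu := h.upper
      rcases h56 with ⟨e5, e6, hle⟩ | ⟨e5, e6, hlt⟩
      · rw [e5, e6]
        exact ⟨h.nat5, by omega, by omega⟩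
      · rw [e5, e6, pow_succ, ← h.nat5]
        exact ⟨by omega, by omega, by omega⟩
    have hdual : DualBound f ε (2 * G + ε) s₅.out (s₅.getMat n 0) := by
      rw [hout, hA']
      exact h.dual.append hG hε (hO.convex j) hxs (hO.diff j x hxs) (hO.bound j x hxs) hj
    have hreg : RegretBound (T + 1) (s₅.getMat n 0) := by
      rw [hA']
      refine h.regret.succ hn hxs hmin ?_ (abs_cutVec_le hG hε (hO.bound j x hxs) hxs)
      rw [cutVec_dotProduct _ _ _ hxs]
      simp
    have hlen : s₅.out.length = T + 1 := by rw [hout]; simp [h.length]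
    refine ⟨_, _, hexec, ?_, ?_, ?_⟩
    · have hg1 : Small 0 1 0 [Event.gradient] := ⟨by decide, by decide, by decide⟩
      have := Small.append (Small.steps (show 3 ≤ 40 by norm_num)) (hg1.append (Small.steps hk))
      exact ⟨this.step.trans (by omega), this.gradient, this.project⟩
    · simp [List.count_append, steps_count_of_ne]
    · have h2 := h45.nat2
      rw [← h45.real, hreal 3 (by norm_num), hreal 1 (by norm_num), h.real3, h.real1, h4,
        hnat 2 (by norm_num) (by norm_num) (by norm_num), h.nat2] at h2
      rcases h2 with ⟨h2, htest⟩ | ⟨h2, htest⟩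
      · refine .inl ⟨h2, .inr ⟨by rw [h1]; norm_num, ?_⟩⟩
        rw [threshold] at htest
        split_ifs at htest with hGε
        · have hT0 : T = 0 := by
            rcases h.notDone with h0 | h0
            · exact h0
            · rw [threshold, if_pos hGε, zero_mul] at h0
              have : (T : ℝ) ≤ 0 := by
                by_contra! hc
                nlinarith
              exact Nat.le_zero.1 (by exact_mod_cast this)
          have : s.out = [] := List.length_eq_zero_iff.1 (h.length.trans hT0)
          rw [hout, this]
          exact isDualProof_singleton hG hε hGε (hO.convex j) hxs (hO.diff j x hxs)
            (hO.bound j x hxs) hj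
        · refine isDualProof_of_bounds hG hε hn hdual (by rwa [hlen]) (m := s₅.nat 6) ?_ ?_
          · rw [hlen, ← hpow.1]
            exact hpow.2.1
          · rwa [hlen]
      · refine .inr ⟨?_, h1, h2, h4, hpow.1, hpow.2.1, hpow.2.2, ?_, ?_, ?_, ?_, hreg, hlen, hdual,
          .inr htest⟩
        · rw [h45.nat 0 (by norm_num), hnat 0 (by norm_num) (by norm_num) (by norm_num), h.nat0]
        · rw [hreal 1 (by norm_num), h.real1]
        · rw [hreal 3 (by norm_num), h.real3]
        · rw [hreal 4 (by norm_num), h.real4]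
        · intro i hi
          rw [h45.vec, h34.vec]
          simpa [hs₃', hs₂, hs₁, State.putVec, State.answer] using h.vec i hi

/-- Induction on the number `r` of rounds left. The invariant itself bounds T, so `r = 0` cannot
occur, and this yields termination. -/
theorem exec_loop (hO : ValidInstance f G ε O) {M : ℕ}
    (hM : ∀ T s, LoopInv f G ε T s → T ≤ M) (r : ℕ) : ∀ T s, T + r = M + 1 →
      LoopInv f G ε T s → ∃ t s', Exec O (.loop (.natLt (.var 2) (.const 1)) bodyProg) s t s' ∧
        s'.Correct f ε (2 * G + ε) ∧ T + t.count .separate ≤ M + 1 ∧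
        SmallBlocks (100 * (n + 1) ^ 2 + 40) t := by
  induction r with
  | zero =>
    intro T s hT h
    have := hM T s h
    omega
  | succ r ih =>
    intro T s hT h
    have hb : (BExpr.natLt (.var 2) (.const 1)).holds s := by
      simp [BExpr.holds, NExpr.eval, h.nat2]
    obtain ⟨rest, s₁, he, hsmall, hcount, hs₁⟩ := exec_bodyProg hO h
    have hfirst : (steps 3).count Event.separate = 0 := steps_count_of_ne 3 (by decide)
    rcases hs₁ with ⟨h2, hc⟩ | hinv
    · have hb' : ¬ (BExpr.natLt (.var 2) (.const 1)).holds s₁ := by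
        simp [BExpr.holds, NExpr.eval, h2]
      refine ⟨_, s₁, Exec.loopStep hb he (Exec.loopDone hb'), hc, ?_,
        (SmallBlocks.steps _).cons hsmall⟩
      simp [List.count_append, steps_count_of_ne, hcount]
      omega
    · obtain ⟨t, s', he', hc, hcnt, hblocks⟩ := ih (T + 1) s₁ (by omega) hinv
      refine ⟨_, s', Exec.loopStep hb he he', hc, ?_, hblocks.cons hsmall⟩
      simp [List.count_append, steps_count_of_ne, hcount]
      omega

theorem exec_mainProg (hO : ValidInstance f G ε O) : ∃ t s',
    Exec O mainProg (State.input ι n G ε) t s' ∧ s'.Correct f ε (2 * G + ε) ∧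
      (t.count .separate : ℝ) ≤ 1500 * (1 + n * G / ε) * Real.log (2 + n * G / ε) ∧
      ∀ block, block <:+: t → Event.separate ∉ block →
        Small (100 * (n + 1) ^ 2 + 43) 1 1 block := by
  obtain ⟨k, hk, s₀, he₀, h₀, hmat⟩ := computes_initProg (ι := ι) (O := O) G ε
  have hA : s₀.getMat n 0 = (n : ℝ) • (1 : Matrix (Fin n) (Fin n) ℝ) := by
    ext a b
    simp [State.getMat, hmat a a.2 b b.2, one_apply, Fin.ext_iff]
  have hinv : LoopInv f G ε 0 s₀ := by
    have h6 := h₀.nat 6 (by norm_num) (by norm_num) (by norm_num)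
    refine ⟨h₀.nat0, h₀.nat 1 (by norm_num) (by norm_num) (by norm_num),
      h₀.nat 2 (by norm_num) (by norm_num) (by norm_num),
      h₀.nat 4 (by norm_num) (by norm_num) (by norm_num), by rw [h₀.nat5, h6, pow_zero],
      by rw [h₀.nat5], by rw [h₀.nat5]; norm_num, h₀.real1, h₀.real3, h₀.real4,
      fun i _ => by rw [h₀.vec], ?_, by rw [h₀.out]; rfl, ?_, .inl rfl⟩
    · rw [hA]
      exact regretBound_zero hO.one_le
    · rw [hA, h₀.out]
      exact dualBound_nil f hO.nonneg hO.pos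
  set R : ℝ := 1500 * (1 + n * G / ε) * Real.log (2 + n * G / ε) with hR
  have hR1 : 1 ≤ R := by simpa using hinv.count_le hO
  -- The truncated subtraction is harmless since R ≥ 1; `M + 1` is then ⌊R⌋.
  have hM : ∀ T s, LoopInv f G ε T s → T ≤ ⌊R⌋₊ - 1 := by
    intro T s h
    have : T + 1 ≤ ⌊R⌋₊ := Nat.le_floor (by push_cast; exact h.count_le hO)
    omega
  obtain ⟨t, s', he, hc, hcnt, hblocks⟩ := exec_loop hO hM _ 0 s₀ (zero_add _) hinv
  refine ⟨_, s', he₀.seq he, hc, ?_, ?_⟩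
  · rw [List.count_append, steps_count_of_ne _ (by decide), zero_add]
    have h1 : 1 ≤ ⌊R⌋₊ := Nat.le_floor (by simpa using hR1)
    exact (Nat.cast_le.2 (by omega : t.count Event.separate ≤ ⌊R⌋₊)).trans
      (Nat.floor_le (by linarith))
  -- The initialization plays the role of the prefix before the first loop test.
  · have hpre : Small (100 * (n + 1) ^ 2 + 40) 1 0 (steps k) := by
      have h := Small.steps (show k ≤ 100 * (n + 1) ^ 2 + 40 by nlinarith)
      exact ⟨h.step, h.gradient.trans (by norm_num), h.project⟩
    exact fun block hb he => hblocks _ hpre block hb he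

end RealRAM

theorem mainTheorem2 :
    ∃ (prog : RealRAM.Prog) (C : ℝ) (k : ℕ),
      ∀ (n : ℕ) (_ : 1 ≤ n) (ι : Type*) (f : ι → RealRAM.Vec n → ℝ) (G ε : ℝ)
        (_ : 0 ≤ G) (_ : 0 < ε)
        (_ : ∀ j, ConvexOn ℝ (RealRAM.simplex n) (f j))
        (_ : ∀ j, ∀ x ∈ RealRAM.simplex n, DifferentiableAt ℝ (f j) x)
        (_ : ∀ j, ∀ x ∈ RealRAM.simplex n, ‖gradient (f j) x‖ ≤ G)
        (sep : RealRAM.Vec n → Option ι) (_ : RealRAM.IsSeparationOracle f ε sep)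
        (P : RealRAM.Vec n → Matrix (Fin n) (Fin n) ℝ → RealRAM.Vec n)
        (_ : RealRAM.IsGeneralizedProjection P),
        ∃ (trace : List RealRAM.Event) (s : RealRAM.State ι),
          RealRAM.Exec ⟨sep, fun j x => gradient (f j) x, P⟩ prog
            (RealRAM.State.input ι n G ε) trace s ∧
          s.Correct f ε (2 * G + ε) ∧
          (trace.count RealRAM.Event.separate : ℝ) ≤
            C * (1 + n * G / ε) * Real.log (2 + n * G / ε) ^ k ∧
          ∀ block : List RealRAM.Event, block <:+: trace → RealRAM.Event.separate ∉ block →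
            (block.count RealRAM.Event.step : ℝ) ≤ C * (n : ℝ) ^ 2 * (1 + Real.log n) ^ k ∧
            block.count RealRAM.Event.gradient ≤ 1 ∧
            block.count RealRAM.Event.project ≤ 1 := by
  refine ⟨RealRAM.mainProg, 1500, 1, fun n hn ι f G ε hG hε hconv hdiff hgrad sep hsep P hP => ?_⟩
  obtain ⟨t, s, he, hc, hcnt, hblocks⟩ := RealRAM.exec_mainProg (G := G) (ε := ε)
    (O := ⟨sep, fun j x => gradient (f j) x, P⟩)
    ⟨hn, hG, hε, hconv, hdiff, hgrad, hsep, rfl, hP⟩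
  refine ⟨t, s, he, hc, by simpa using hcnt, fun block hb hs => ?_⟩
  obtain ⟨h1, h2, h3⟩ := hblocks block hb hs
  refine ⟨?_, h2, h3⟩
  have hn1 : (1 : ℝ) ≤ n := by exact_mod_cast hn
  have hlog : 0 ≤ Real.log n := Real.log_nonneg hn1
  have h4 : (block.count RealRAM.Event.step : ℝ) ≤ 100 * ((n : ℝ) + 1) ^ 2 + 43 := by
    exact_mod_cast h1
  -- As n ≥ 1, (n + 1)² ≤ 4n², so 443 would suffice here; 1500 comes from the count of calls.
  have h5 : 100 * ((n : ℝ) + 1) ^ 2 + 43 ≤ 1500 * (n : ℝ) ^ 2 := by nlinarith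
  rw [pow_one]
  have h6 : 0 ≤ 1500 * (n : ℝ) ^ 2 * Real.log n := by positivity
  linarith
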